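/- Let $\lambda>0$ and $t\in(0,1)$. Identify $\mathrm{Gr}(2,4)$ with the adjoint orbit $\mathcal O_\lambda$ of Hermitian $4\times4$ matrices $x=(x_{kl})$ with eigenvalues $\lambda,\lambda,0,0$. Let $\psi_{12}=x_{11}$, $\psi_{23}=x_{22}$, $\psi_{34}=x_{33}$, let $\psi_{13}(x)$ and $\psi_{24}(x)$ be the largest eigenvalues of $(x_{kl})_{k,l\in\{1,2\}}$ and $(x_{kl})_{k,l\in\{2,3\}}$, and put $\varphi_{13}=\psi_{13}-\tfrac12(\psi_{12}+\psi_{23})$, $\varphi_{24}=\psi_{24}-\tfrac12(\psi_{23}+\psi_{34})$. Consider $$\Psi_t=\bigl(\psi_{12},\psi_{23},\psi_{34},(1-t)\varphi_{13}^2-t\varphi_{24}^2\bigr):\mathcal O_\lambda\to\mathbb R^4,\qquad B_t=\Psi_t(\mathcal O_\lambda),$$ and let the discriminant locus $D_t\subset B_t$ be the set of points whose fiber is singular, i.e. contains a point of $\mathcal O_\lambda$ at which the differential of $\Psi_t$ is not surjective. Let $H_2=\{r\in\mathbb R^4: r_1+r_2+r_3+r_4=\lambda,\ r_1+r_3=r_2+r_4\}$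 and $$S_t=\left\{u\in\mathbb R^4 : r=\left(\tfrac{u_1}2,\tfrac{u_2}2,\tfrac{u_3}2,\lambda-\tfrac12(u_1+u_2+u_3)\right)\in H_2,\ u_4=(1-t)(r_1-r_2)^2-t(r_1-r_4)^2\right\}.$$ Then $$S_t=\{(2r_1,2r_2,2r_3,(1-t)(r_1-r_2)^2-t(r_1-r_4)^2): r\in H_2\},$$ and the discriminant locus inside the interior of $B_t$ (in $\mathbb R^4$) is $S_t$, that is, $$D_t\cap\operatorname{Int}B_t=S_t\cap\operatorname{Int}B_t.$$ Moreover $D_t\cap\operatorname{Int}B_t$ is a nonempty smooth embedded submanifold of $\mathbb R^4$ of codimension two. -/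

import Mathlib

open scoped ContDiff

/-- A `4 × 4` complex matrix. -/
abbrev Mat4 : Type := Matrix (Fin 4) (Fin 4) ℂ

/-- The adjoint orbit `𝒪_λ ≅ Gr(2,4)`: Hermitian `4 × 4` matrices whose eigenvalues, with
multiplicity, are `λ, λ, 0, 0`. -/
def adjointOrbit (lam : ℝ) : Set Mat4 :=
  {x | x.IsHermitian ∧ x.charpoly.roots = {(lam : ℂ), (lam : ℂ), 0, 0}}

/-- The largest real eigenvalue of a `2 × 2` matrix (only used for Hermitian ones, all of whose
eigenvalues are real). -/
noncomputable def largestEigenvalue (A : Matrix (Fin 2) (Fin 2) ℂ) : ℝ :=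
  sSup {μ : ℝ | Module.End.HasEigenvalue (Matrix.toLin' A) (μ : ℂ)}

/-- `psi12`, `psi23`, `psi34` are the (real) diagonal entries `x₁₁`, `x₂₂`, `x₃₃`. -/
def psi12 (x : Mat4) : ℝ := (x 0 0).re

/-- See `psi12`. -/
def psi23 (x : Mat4) : ℝ := (x 1 1).re

/-- See `psi12`. -/
def psi34 (x : Mat4) : ℝ := (x 2 2).re

/-- The largest eigenvalue of the diagonal block with (1-based) rows and columns `1, 2`. -/
noncomputable def psi13 (x : Mat4) : ℝ := largestEigenvalue (x.submatrix ![0, 1] ![0, 1])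

/-- The largest eigenvalue of the diagonal block with (1-based) rows and columns `2, 3`. -/
noncomputable def psi24 (x : Mat4) : ℝ := largestEigenvalue (x.submatrix ![1, 2] ![1, 2])

/-- The bending Hamiltonian of the diagonal `d₁₃`. -/
noncomputable def phi13 (x : Mat4) : ℝ := psi13 x - (psi12 x + psi23 x) / 2

/-- The bending Hamiltonian of the diagonal `d₂₄`. -/
noncomputable def phi24 (x : Mat4) : ℝ := psi24 x - (psi23 x + psi34 x) / 2

/-- The map `Ψ_t = (ψ₁₂, ψ₂₃, ψ₃₄, (1 - t) φ₁₃² - t φ₂₄²)`. -/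
noncomputable def Psi (t : ℝ) (x : Mat4) : Fin 4 → ℝ :=
  ![psi12 x, psi23 x, psi34 x, (1 - t) * phi13 x ^ 2 - t * phi24 x ^ 2]

/-- The image `B_t = Ψ_t(Gr(2,4))`. -/
def baseSpace (lam t : ℝ) : Set (Fin 4 → ℝ) := Psi t '' adjointOrbit lam

/-- `γ` is a smooth curve in the orbit with `γ(0) = x`. -/
def IsSmoothCurveAt (lam : ℝ) (x : Mat4) (γ : ℝ → Mat4) : Prop :=
  (∀ i j, ContDiff ℝ ∞ fun s => γ s i j) ∧ (∀ s, γ s ∈ adjointOrbit lam) ∧ γ 0 = x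

/-- `x` is a regular point of `Ψ_t` on the orbit: the differential `T_x 𝒪_λ → ℝ⁴` is onto, where
tangent vectors are velocities of smooth curves in `𝒪_λ` through `x`. -/
def IsRegularPoint (lam t : ℝ) (x : Mat4) : Prop :=
  ∀ w : Fin 4 → ℝ, ∃ γ : ℝ → Mat4,
    IsSmoothCurveAt lam x γ ∧ HasDerivAt (fun s => Psi t (γ s)) w 0

/-- The discriminant locus of `Ψ_t`: the points whose fiber in the orbit is singular, that is,
contains a critical point of `Ψ_t`. -/
def discriminantLocus (lam t : ℝ) : Set (Fin 4 → ℝ) :=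
  {u | ∃ x ∈ adjointOrbit lam, Psi t x = u ∧ ¬ IsRegularPoint lam t x}

/-- The wall `H₂ = {r₁ + r₃ = r₂ + r₄}` in the hyperplane `r₁ + r₂ + r₃ + r₄ = λ`. -/
def wallH2 (lam : ℝ) : Set (Fin 4 → ℝ) :=
  {r | r 0 + r 1 + r 2 + r 3 = lam ∧ r 0 + r 2 = r 1 + r 3}

/-- The point `r = (u₁/2, u₂/2, u₃/2, λ - (u₁ + u₂ + u₃)/2)`. -/
noncomputable def sideLengths (lam : ℝ) (u : Fin 4 → ℝ) : Fin 4 → ℝ :=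
  ![u 0 / 2, u 1 / 2, u 2 / 2, lam - (u 0 + u 1 + u 2) / 2]

/-- The value `(1 - t)(r₁ - r₂)² - t (r₁ - r₄)²`. -/
def nodeValue (t : ℝ) (r : Fin 4 → ℝ) : ℝ :=
  (1 - t) * (r 0 - r 1) ^ 2 - t * (r 0 - r 3) ^ 2

/-- `S ⊆ ℝⁿ` is a smooth embedded submanifold of codimension `k`: near each of its points it is
the zero set of a smooth submersion to `ℝᵏ`. -/
def IsSmoothSubmanifoldOfCodim {n : ℕ} (k : ℕ) (S : Set (Fin n → ℝ)) : Prop :=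
  ∀ p ∈ S, ∃ (U : Set (Fin n → ℝ)) (g : (Fin n → ℝ) → (Fin k → ℝ)),
    IsOpen U ∧ p ∈ U ∧ ContDiffOn ℝ ∞ g U ∧
    (∀ q ∈ U, Function.Surjective (fderiv ℝ g q)) ∧
    S ∩ U = {q ∈ U | g q = 0}

open scoped Matrix

/-! The proof translates the orbit into spatial quadrilaterals. A point of the orbit is a Gram
matrix `Z * Zᴴ` with `Zᴴ * Z = λ`. The Hopf map sends the rows of `Z` to vectors `e i` of `ℝ³` of
length `x i i / 2`, and `Zᴴ * Z = λ` says exactly that these edges close up and have perimeter `λ`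
(`frame_iff`, `exists_frame_of_polygon`). Then `φ₁₃² = |e₁ + e₂|²` and `φ₂₄² = |e₂ + e₃|²`, so `Ψ_t`
records three side lengths and, up to a function of these, `bendingEnergy`.

At a critical point a nonzero combination of gradients commutes with `x`
(`exists_commute_of_not_surjective`). On edges this becomes a Lagrange multiplier equation
(`lagrange_of_commute`). If the polygon is not collinear, the Lagrangian has rank one, hence is
semidefinite, and the polygon is a global extremum of the energy for its side lengths
(`critical_polygon`). This cannot happen over the interior of `B_t`, where the fourth coordinate
moves both ways. If the polygon is collinear, its sign pattern gives a side of half the perimeter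
(excluded in the interior), again an extremum, or alternating directions, which is the wall `H₂`
with the stated value (`collinear_polygon`).

Conversely, over a point of the wall in `B_t` the alternating polygon makes `x` commute with
`diag(1,0,1,0)`, so the differential of `ψ₁₂ + ψ₃₄` vanishes there (`exists_node`). Nonemptiness
comes from a regular equilateral polygon over the centre of the wall, and smoothness from the wall
being a graph over an affine plane. -/

/-! ### The orbit as Gram matrices of frames. -/

theorem sum_fin_four_eq_pair {M : Type*} [AddCommMonoid M] {f : Fin 4 → M} {a b : Fin 4}
    (hab : a ≠ b) (h : ∀ i, i ≠ a → i ≠ b → f i = 0) : ∑ i, f i = f a + f b := by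
  rw [← Finset.sum_pair hab]
  symm
  apply Finset.sum_subset (Finset.subset_univ _)
  intro i _ hi
  simp only [Finset.mem_insert, Finset.mem_singleton, not_or] at hi
  exact h i hi.1 hi.2

/-- Points of the orbit are the Gram matrices of `4`-frames in `ℂ²` with orthogonal columns of
square length `λ`. -/
theorem exists_frame_of_mem_adjointOrbit {lam : ℝ} (hlam : 0 < lam) {x : Mat4}
    (hx : x ∈ adjointOrbit lam) :
    ∃ Z : Matrix (Fin 4) (Fin 2) ℂ, Zᴴ * Z = (lam : ℂ) • 1 ∧ x = Z * Zᴴ := by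
  obtain ⟨hH, hr⟩ := hx
  rw [hH.roots_charpoly_eq_eigenvalues] at hr
  have hl0 : (lam : ℂ) ≠ 0 := by exact_mod_cast hlam.ne'
  have hmem : ∀ i, hH.eigenvalues i = lam ∨ hH.eigenvalues i = 0 := by
    intro i
    have : ((hH.eigenvalues i : ℝ) : ℂ) ∈ ({(lam : ℂ), (lam : ℂ), 0, 0} : Multiset ℂ) := by
      rw [← hr]
      exact Multiset.mem_map.2 ⟨i, by simp, rfl⟩
    simpa using this
  -- The multiplicity of `λ` among the roots is exactly two because `λ ≠ 0`.
  have hcard : (Finset.univ.filter fun i => hH.eigenvalues i = lam).card = 2 := by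
    have := congrArg (Multiset.count (lam : ℂ)) hr
    rw [Multiset.count_map] at this
    simp only [Multiset.insert_eq_cons, Multiset.count_cons_self, Multiset.count_cons_of_ne hl0,
      Multiset.count_singleton, if_neg hl0] at this
    refine Eq.trans ?_ this
    rw [Finset.card, Finset.filter_val]
    congr 1
    apply Multiset.filter_congr
    intro i _
    simp [eq_comm]
  obtain ⟨a, b, hab, hs⟩ := Finset.card_eq_two.1 hcard
  have ha : hH.eigenvalues a = lam := by
    have : a ∈ Finset.univ.filter fun i => hH.eigenvalues i = lam := by rw [hs]; simp
    simpa using this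
  have hb : hH.eigenvalues b = lam := by
    have : b ∈ Finset.univ.filter fun i => hH.eigenvalues i = lam := by rw [hs]; simp
    simpa using this
  have hc : ∀ i, i ≠ a → i ≠ b → hH.eigenvalues i = 0 := by
    intro i h1 h2
    refine (hmem i).resolve_left fun h => ?_
    have : i ∈ Finset.univ.filter fun i => hH.eigenvalues i = lam := by simpa using h
    rw [hs] at this
    simp [h1, h2] at this
  set U : Mat4 := (hH.eigenvectorUnitary : Mat4) with hU
  have hUU : Uᴴ * U = 1 := Unitary.coe_star_mul_self hH.eigenvectorUnitary
  have hspec : x = U * Matrix.diagonal (fun i => ((hH.eigenvalues i : ℝ) : ℂ)) * Uᴴ := by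
    conv_lhs => rw [hH.spectral_theorem, Unitary.conjStarAlgAut_apply]
    rfl
  have hsq : ((Real.sqrt lam : ℝ) : ℂ) * ((Real.sqrt lam : ℝ) : ℂ) = lam := by
    rw [← Complex.ofReal_mul, Real.mul_self_sqrt hlam.le]
  have horth : ∀ i j, ∑ k, star (U k i) * U k j = if i = j then 1 else 0 := by
    intro i j
    have := congrFun (congrFun hUU i) j
    simpa [Matrix.mul_apply, Matrix.one_apply] using this
  let c : Fin 2 → Fin 4 := ![a, b]
  have hc2 : ∀ i j, (c i = c j) ↔ i = j := by
    intro i j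
    fin_cases i <;> fin_cases j <;> simp [c, hab, hab.symm]
  -- The columns of the frame are `√λ` times the two unit eigenvectors for `λ`.
  refine ⟨Matrix.of fun k j => ((Real.sqrt lam : ℝ) : ℂ) * U k (c j), ?_, ?_⟩
  · ext i j
    have h := horth (c i) (c j)
    simp only [hc2] at h
    simp only [Matrix.mul_apply, Matrix.conjTranspose_apply, Matrix.of_apply, Matrix.smul_apply,
      Matrix.one_apply, star_mul', smul_eq_mul]
    rw [← h, ← hsq, Finset.mul_sum]
    refine Finset.sum_congr rfl fun k _ => ?_
    simp only [RCLike.star_def, Complex.conj_ofReal]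
    ring
  · ext i j
    rw [hspec, Matrix.mul_assoc, Matrix.mul_apply]
    simp only [Matrix.diagonal_mul]
    rw [sum_fin_four_eq_pair hab (fun k h1 h2 => by rw [hc k h1 h2]; simp)]
    simp only [Matrix.mul_apply, Matrix.conjTranspose_apply, Matrix.of_apply, Fin.sum_univ_two,
      ha, hb, c, ← hsq, star_mul', RCLike.star_def, Complex.conj_ofReal, Matrix.cons_val_zero,
      Matrix.cons_val_one]
    ring

/-- Swapping the factors of `Z * Zᴴ` multiplies the characteristic polynomial of `Zᴴ * Z` by `X ^
2`, which supplies the two zero eigenvalues. -/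
theorem mem_adjointOrbit_of_frame {lam : ℝ} (Z : Matrix (Fin 4) (Fin 2) ℂ)
    (hZ : Zᴴ * Z = (lam : ℂ) • 1) : Z * Zᴴ ∈ adjointOrbit lam := by
  refine ⟨Matrix.isHermitian_mul_conjTranspose_self Z, ?_⟩
  have h := Matrix.charpoly_mul_comm_of_le Z Zᴴ (by simp)
  have hp : (Zᴴ * Z).charpoly = (Polynomial.X - Polynomial.C (lam : ℂ)) ^ 2 := by
    rw [hZ, Matrix.smul_one_eq_diagonal, Matrix.charpoly_diagonal]
    simp [sq]
  rw [h, hp]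
  have h1 : (Polynomial.X - Polynomial.C (lam : ℂ)) ^ 2 ≠ 0 :=
    pow_ne_zero _ (Polynomial.X_sub_C_ne_zero _)
  rw [Polynomial.roots_mul (mul_ne_zero (pow_ne_zero _ Polynomial.X_ne_zero) h1)]
  simp only [Polynomial.roots_pow, Polynomial.roots_X, Polynomial.roots_X_sub_C,
    Fintype.card_fin]
  simp only [two_nsmul, show 4 - 2 = 2 from rfl]
  rw [add_comm]
  rfl

theorem conj_mem_adjointOrbit {lam : ℝ} {x : Mat4} (hx : x ∈ adjointOrbit lam) {U V : Mat4}
    (hUV : U * Uᴴ = 1) (hV : V = Uᴴ) : U * x * V ∈ adjointOrbit lam := by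
  subst hV
  refine ⟨Matrix.isHermitian_mul_mul_conjTranspose U hx.1, ?_⟩
  rw [Matrix.charpoly_mul_comm, ← Matrix.mul_assoc, mul_eq_one_comm.1 hUV, Matrix.one_mul, hx.2]

/-! ### The map `Ψ_t` as a polynomial in the matrix entries. -/

theorem largestEigenvalue_eq {A : Matrix (Fin 2) (Fin 2) ℂ} (hA : A.IsHermitian) :
    largestEigenvalue A = ((A 0 0).re + (A 1 1).re) / 2 +
      Real.sqrt (((A 0 0).re - (A 1 1).re) ^ 2 / 4 + Complex.normSq (A 0 1)) := by
  set a := (A 0 0).re with ha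
  set b := (A 1 1).re with hb
  set d := (a - b) ^ 2 / 4 + Complex.normSq (A 0 1) with hd
  have hd0 : 0 ≤ d := add_nonneg (by positivity) (Complex.normSq_nonneg _)
  have h00 : A 0 0 = (a : ℂ) := by
    rw [ha]; exact (Complex.conj_eq_iff_re.1 (hA.apply 0 0)).symm
  have h11 : A 1 1 = (b : ℂ) := by
    rw [hb]; exact (Complex.conj_eq_iff_re.1 (hA.apply 1 1)).symm
  have h10 : A 1 0 = (starRingEnd ℂ) (A 0 1) := (hA.apply 1 0).symm
  have hdet : A 0 1 * A 1 0 = (Complex.normSq (A 0 1) : ℂ) := by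
    rw [h10, Complex.mul_conj]
  -- Completing the square in the characteristic polynomial.
  have hmem : ∀ μ : ℝ, Module.End.HasEigenvalue (Matrix.toLin' A) (μ : ℂ) ↔
      (μ - (a + b) / 2) ^ 2 = d := by
    intro μ
    rw [Module.End.hasEigenvalue_iff_isRoot_charpoly, Matrix.charpoly_toLin',
      Matrix.charpoly_fin_two, Polynomial.IsRoot.def, Matrix.trace_fin_two, Matrix.det_fin_two,
      hdet, h00, h11]
    simp only [Polynomial.eval_add, Polynomial.eval_sub, Polynomial.eval_pow, Polynomial.eval_X,
      Polynomial.eval_mul, Polynomial.eval_C]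
    norm_cast
    rw [hd]
    constructor <;> intro h <;> linear_combination h
  have hG : IsGreatest {μ : ℝ | Module.End.HasEigenvalue (Matrix.toLin' A) (μ : ℂ)}
      ((a + b) / 2 + Real.sqrt d) := by
    constructor
    · rw [Set.mem_ofPred_eq, hmem]
      rw [add_sub_cancel_left, Real.sq_sqrt hd0]
    · intro μ hμ
      rw [Set.mem_ofPred_eq, hmem] at hμ
      have := Real.le_sqrt_of_sq_le hμ.le
      linarith
  exact hG.csSup_eq

/-- The value of `Ψ_t` at a Hermitian matrix, as a polynomial in its entries. -/
noncomputable def psiPoly (t : ℝ) (x : Mat4) : Fin 4 → ℝ :=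
  ![(x 0 0).re, (x 1 1).re, (x 2 2).re,
    (1 - t) * (((x 0 0).re - (x 1 1).re) ^ 2 / 4 + Complex.normSq (x 0 1)) -
      t * (((x 1 1).re - (x 2 2).re) ^ 2 / 4 + Complex.normSq (x 1 2))]

/-- Each `φ` is a square root and enters only through its square, so `Ψ_t` stays smooth where the
eigenvalues of a block collide. -/
theorem Psi_eq_psiPoly (t : ℝ) {x : Mat4} (hx : x.IsHermitian) : Psi t x = psiPoly t x := by
  have h1 : phi13 x ^ 2 = ((x 0 0).re - (x 1 1).re) ^ 2 / 4 + Complex.normSq (x 0 1) := by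
    rw [phi13, psi13, largestEigenvalue_eq (hx.submatrix _), psi12, psi23]
    simp only [Matrix.submatrix_apply, Matrix.cons_val_zero, Matrix.cons_val_one]
    rw [add_sub_cancel_left, Real.sq_sqrt]
    exact add_nonneg (by positivity) (Complex.normSq_nonneg _)
  have h2 : phi24 x ^ 2 = ((x 1 1).re - (x 2 2).re) ^ 2 / 4 + Complex.normSq (x 1 2) := by
    rw [phi24, psi24, largestEigenvalue_eq (hx.submatrix _), psi23, psi34]
    simp only [Matrix.submatrix_apply, Matrix.cons_val_zero, Matrix.cons_val_one]
    rw [add_sub_cancel_left, Real.sq_sqrt]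
    exact add_nonneg (by positivity) (Complex.normSq_nonneg _)
  rw [Psi, psiPoly, h1, h2]
  rfl

/-! ### Spatial polygons and the Hopf map. -/

/-- The `i`-th edge, a vector of `ℝ³`, of the spatial polygon defined by a frame. -/
noncomputable def edge (Z : Matrix (Fin 4) (Fin 2) ℂ) (i : Fin 4) : Fin 3 → ℝ :=
  ![(Z i 0 * star (Z i 1)).re, (Z i 0 * star (Z i 1)).im,
    (Complex.normSq (Z i 0) - Complex.normSq (Z i 1)) / 2]

theorem gram_diag_re (Z : Matrix (Fin 4) (Fin 2) ℂ) (i : Fin 4) :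
    ((Z * Zᴴ) i i).re = Complex.normSq (Z i 0) + Complex.normSq (Z i 1) := by
  simp [Matrix.mul_apply, Complex.normSq_apply]

/-- This turns `|x i j|²` into polygon geometry: edges are antiparallel with product `-(r i * r j)`
exactly when `x i j = 0`. -/
theorem edge_dot_edge (Z : Matrix (Fin 4) (Fin 2) ℂ) (i j : Fin 4) :
    edge Z i ⬝ᵥ edge Z j = Complex.normSq ((Z * Zᴴ) i j) / 2 -
      ((Z * Zᴴ) i i).re / 2 * (((Z * Zᴴ) j j).re / 2) := by
  rw [gram_diag_re, gram_diag_re]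
  simp only [edge, dotProduct, Fin.sum_univ_three, Matrix.mul_apply, Fin.sum_univ_two,
    Matrix.conjTranspose_apply, Matrix.cons_val, Complex.normSq_apply, Complex.star_def,
    Complex.mul_re, Complex.mul_im, Complex.conj_re, Complex.conj_im, Complex.add_re,
    Complex.add_im]
  ring

theorem frame_entry {lam : ℝ} {Z : Matrix (Fin 4) (Fin 2) ℂ} (hZ : Zᴴ * Z = (lam : ℂ) • 1)
    (i j : Fin 2) : ∑ k, star (Z k i) * Z k j = if i = j then (lam : ℂ) else 0 := by
  have := congrFun (congrFun hZ i) j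
  simpa [Matrix.mul_apply, Matrix.one_apply] using this

/-- The first two coordinates of the edge sum are the real and imaginary parts of the off-diagonal
entry of `Zᴴ * Z`, up to conjugation; the third is half the difference of its diagonal entries. -/
theorem frame_iff (lam : ℝ) (Z : Matrix (Fin 4) (Fin 2) ℂ) :
    Zᴴ * Z = (lam : ℂ) • 1 ↔
      (∀ a, ∑ i, edge Z i a = 0) ∧
        ∑ i, (Complex.normSq (Z i 0) + Complex.normSq (Z i 1)) = 2 * lam := by
  constructor
  · intro hZ
    have h00 := congrArg Complex.re (frame_entry hZ 0 0)
    have h11 := congrArg Complex.re (frame_entry hZ 1 1)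
    have h10 := frame_entry hZ 1 0
    have h10r := congrArg Complex.re h10
    have h10i := congrArg Complex.im h10
    simp [Fin.sum_univ_four] at h00 h11 h10r h10i
    refine ⟨?_, ?_⟩
    · intro a
      fin_cases a <;> simp [edge, Fin.sum_univ_four, Complex.normSq_apply] <;> linarith
    · simp [Fin.sum_univ_four, Complex.normSq_apply]
      linarith
  · rintro ⟨h, hs⟩
    have h0 := h 0
    have h1 := h 1
    have h2 := h 2
    simp [edge, Fin.sum_univ_four, Complex.normSq_apply] at h0 h1 h2 hs
    ext i j
    fin_cases i <;> fin_cases j <;> apply Complex.ext <;>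
      simp [Matrix.mul_apply, Fin.sum_univ_four] <;> linarith

/-- A section of the Hopf map with `p` real. It breaks down only at the south pole `e 2 = -r`, where
`p = 0` is taken. -/
theorem exists_spinor (e : Fin 3 → ℝ) (r : ℝ) (hr : 0 ≤ r) (he : e ⬝ᵥ e = r ^ 2) :
    ∃ p q : ℂ, (p * star q).re = e 0 ∧ (p * star q).im = e 1 ∧
      (Complex.normSq p - Complex.normSq q) / 2 = e 2 ∧
      Complex.normSq p + Complex.normSq q = 2 * r := by
  simp only [dotProduct, Fin.sum_univ_three] at he
  have hle : -r ≤ e 2 := by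
    have : |e 2| ≤ r := abs_le_of_sq_le_sq (by nlinarith [sq_nonneg (e 0), sq_nonneg (e 1)]) hr
    exact (abs_le.1 this).1
  rcases hle.eq_or_lt with h | h
  · have h0 : e 0 = 0 := by nlinarith [sq_nonneg (e 0), sq_nonneg (e 1)]
    have h1 : e 1 = 0 := by nlinarith [sq_nonneg (e 0), sq_nonneg (e 1)]
    obtain ⟨s, hs⟩ : ∃ s : ℝ, s * s = 2 * r :=
      ⟨_, Real.mul_self_sqrt (show 0 ≤ 2 * r by linarith)⟩
    refine ⟨0, (s : ℝ), ?_, ?_, ?_, ?_⟩ <;>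
      simp [h0, h1, ← h, Complex.normSq_apply, hs]
    ring
  · have hpos : 0 < r + e 2 := by linarith
    set s := Real.sqrt (r + e 2) with hs
    have hs2 : s * s = r + e 2 := Real.mul_self_sqrt hpos.le
    have hs0 : s ≠ 0 := (Real.sqrt_pos.2 hpos).ne'
    have hq : (e 0 / s) * (e 0 / s) + (e 1 / s) * (e 1 / s) = r - e 2 := by
      field_simp
      nlinarith
    refine ⟨(s : ℝ), ⟨e 0 / s, -(e 1 / s)⟩, ?_, ?_, ?_, ?_⟩
    · simp; field_simp
    · simp; field_simp
    · simp [Complex.normSq_apply]; linarith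
    · simp [Complex.normSq_apply]; linarith

/-- Every closed spatial quadrilateral of perimeter `λ` comes from a point of the orbit. -/
theorem exists_frame_of_polygon {lam : ℝ} (e : Fin 4 → Fin 3 → ℝ) (r : Fin 4 → ℝ)
    (hr : ∀ i, 0 ≤ r i) (he : ∀ i, e i ⬝ᵥ e i = r i ^ 2) (hsum : ∀ a, ∑ i, e i a = 0)
    (hlam : ∑ i, r i = lam) :
    ∃ Z : Matrix (Fin 4) (Fin 2) ℂ, Zᴴ * Z = (lam : ℂ) • 1 ∧ (∀ i, edge Z i = e i) ∧
      ∀ i, ((Z * Zᴴ) i i).re = 2 * r i := by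
  choose p q h0 h1 h2 h3 using fun i => exists_spinor (e i) (r i) (hr i) (he i)
  have hedge : ∀ i, edge (Matrix.of fun i => ![p i, q i]) i = e i := by
    intro i
    ext a
    fin_cases a
    · exact h0 i
    · exact h1 i
    · exact h2 i
  refine ⟨Matrix.of fun i => ![p i, q i], ?_, hedge, ?_⟩
  · rw [frame_iff]
    refine ⟨fun a => by simpa [hedge] using hsum a, ?_⟩
    rw [← hlam, Finset.mul_sum]
    exact Finset.sum_congr rfl fun i _ => h3 i
  · intro i
    rw [gram_diag_re]
    exact h3 i

/-! ### Critical polygons of the bending energy. -/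

/-- If the row `(p, q) ≠ 0` is annihilated by a Hermitian `2 × 2` matrix, then the traceless part
of the matrix is proportional to the vector of the row. -/
theorem exists_smul_of_row_mul_eq_zero {p q c : ℂ} {a b : ℝ}
    (hpq : 0 < Complex.normSq p + Complex.normSq q)
    (h1 : p * a + q * star c = 0) (h2 : p * c + q * b = 0) :
    ∃ s : ℝ, c.re = s * (p * star q).re ∧ -c.im = s * (p * star q).im ∧
      (a - b) / 2 = s * ((Complex.normSq p - Complex.normSq q) / 2) ∧
      a + b = -s * (Complex.normSq p + Complex.normSq q) := by
  have e1 := congrArg Complex.re h1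
  have e2 := congrArg Complex.im h1
  have e3 := congrArg Complex.re h2
  have e4 := congrArg Complex.im h2
  simp [Complex.normSq_apply] at e1 e2 e3 e4 hpq ⊢
  set n := p.re * p.re + p.im * p.im + (q.re * q.re + q.im * q.im) with hn
  refine ⟨-(a + b) / n, ?_, ?_, ?_, ?_⟩
  · field_simp
    linear_combination q.re * e1 + q.im * e2 + p.re * e3 + p.im * e4 + c.re * hn
  · field_simp
    linear_combination (-q.im) * e1 + q.re * e2 + p.im * e3 - p.re * e4 - c.im * hn
  · field_simp
    rw [hn]
    linear_combination 2 * (p.re * e1 + p.im * e2 - q.re * e3 - q.im * e4)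
  · field_simp

/-- All edges are parallel to one line. -/
def IsCollinear (e : Fin 4 → Fin 3 → ℝ) : Prop :=
  ∀ i j a b, e i a * e j b = e i b * e j a

/-- The nonconstant part of `(1 - t)|e₁ + e₂|² - t|e₂ + e₃|²` for edges of given lengths. -/
def bendingEnergy (α β : ℝ) (e : Fin 4 → Fin 3 → ℝ) : ℝ :=
  2 * α * (e 0 ⬝ᵥ e 1) - 2 * β * (e 1 ⬝ᵥ e 2)

theorem isCollinear_of_forall_eq_smul {e : Fin 4 → Fin 3 → ℝ} {k : Fin 3 → ℝ} {h : Fin 4 → ℝ}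
    (hk : k ≠ 0) (he : ∀ i a, k a = h i * e i a) : IsCollinear e := by
  obtain ⟨c, hc⟩ := Function.ne_iff.1 hk
  have hh : ∀ i, h i ≠ 0 := by
    intro i hi
    apply hc
    rw [he i c, hi]
    simp
  intro i j a b
  have : h i * h j * (e i a * e j b - e i b * e j a) = 0 := by
    have h1 := he i a
    have h2 := he j b
    have h3 := he i b
    have h4 := he j a
    linear_combination (-h j * e j b) * h1 - k a * h2 + (h j * e j a) * h3 + k b * h4
  have := (mul_eq_zero.1 this).resolve_left (mul_ne_zero (hh i) (hh j))
  linarith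

/-- Two vectors of `ℝ³` orthogonal to two independent vectors have vanishing `2 × 2` minors. -/
theorem minors_eq_zero_of_orthogonal {u v x y : Fin 3 → ℝ} {a b : Fin 3}
    (hw : u a * v b - u b * v a ≠ 0) (hxu : x ⬝ᵥ u = 0) (hxv : x ⬝ᵥ v = 0) (hyu : y ⬝ᵥ u = 0)
    (hyv : y ⬝ᵥ v = 0) (c d : Fin 3) : x c * y d = x d * y c := by
  have hcross : u ⨯₃ v ≠ 0 := by
    intro h
    apply hw
    have h0 := congrFun h 0
    have h1 := congrFun h 1
    have h2 := congrFun h 2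
    simp [cross_apply] at h0 h1 h2
    fin_cases a <;> fin_cases b <;> simp <;> linarith
  simp only [dotProduct, Fin.sum_univ_three] at hxu hxv hyu hyv
  set w := u ⨯₃ v with hwdef
  have hw0 : w 0 = u 1 * v 2 - u 2 * v 1 := by simp [hwdef, cross_apply]
  have hw1 : w 1 = u 2 * v 0 - u 0 * v 2 := by simp [hwdef, cross_apply]
  have hw2 : w 2 = u 0 * v 1 - u 1 * v 0 := by simp [hwdef, cross_apply]
  -- A vector orthogonal to `u` and `v` is parallel to `u ⨯₃ v`.
  have key : ∀ z : Fin 3 → ℝ, z 0 * u 0 + z 1 * u 1 + z 2 * u 2 = 0 →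
      z 0 * v 0 + z 1 * v 1 + z 2 * v 2 = 0 → ∀ i j, z i * w j = z j * w i := by
    intro z h1 h2 i j
    fin_cases i <;> fin_cases j <;> simp [hw0, hw1, hw2] <;> try ring1
    · linear_combination u 2 * h2 - v 2 * h1
    · linear_combination v 1 * h1 - u 1 * h2
    · linear_combination v 2 * h1 - u 2 * h2
    · linear_combination u 0 * h2 - v 0 * h1
    · linear_combination u 1 * h2 - v 1 * h1
    · linear_combination v 0 * h1 - u 0 * h2
  obtain ⟨m, hm⟩ := Function.ne_iff.1 hcross
  have hm : w m ≠ 0 := hm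
  have h1 := key x hxu hxv c m
  have h2 := key x hxu hxv d m
  have h3 := key y hyu hyv c m
  have h4 := key y hyu hyv d m
  apply mul_right_cancel₀ (mul_ne_zero hm hm)
  linear_combination (y d * w m) * h1 - (y c * w m) * h2
    + (x m * w c) * h4 - (x m * w d) * h3

/-- A critical polygon of the bending energy, among the polygons with the same side lengths, is
either an extremum or contained in a line: a noncollinear critical polygon has a Lagrangian that
is a quadratic form of rank one. -/
theorem critical_polygon {α β : ℝ} (hα : α ≠ 0) {e : Fin 4 → Fin 3 → ℝ}
    (hsum : ∀ a, ∑ i, e i a = 0) {k : Fin 3 → ℝ} {h : Fin 4 → ℝ}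
    (h0 : ∀ a, k a = α * e 1 a + h 0 * e 0 a)
    (h1 : ∀ a, k a = α * e 0 a - β * e 2 a + h 1 * e 1 a)
    (h2 : ∀ a, k a = -β * e 1 a + h 2 * e 2 a)
    (h3 : ∀ a, k a = h 3 * e 3 a) :
    IsCollinear e ∨
    (∀ f : Fin 4 → Fin 3 → ℝ, (∀ a, ∑ i, f i a = 0) → (∀ i, f i ⬝ᵥ f i = e i ⬝ᵥ e i) →
      bendingEnergy α β e ≤ bendingEnergy α β f) ∨
    (∀ f : Fin 4 → Fin 3 → ℝ, (∀ a, ∑ i, f i a = 0) → (∀ i, f i ⬝ᵥ f i = e i ⬝ᵥ e i) →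
      bendingEnergy α β f ≤ bendingEnergy α β e) := by
  by_cases hcol : IsCollinear e
  · exact Or.inl hcol
  right
  simp only [Fin.sum_univ_four] at hsum ⊢
  -- Matrix of the quadratic form `bendingEnergy α β f + ∑ i, h i * |f i|²` after eliminating `f 3 =
  -- -(f 0 + f 1 + f 2)`. The multiplier equations say that it kills the coordinate columns of `e`.
  let L : Fin 3 → Fin 3 → ℝ :=
    ![![h 0 + h 3, α + h 3, h 3], ![α + h 3, h 1 + h 3, h 3 - β], ![h 3, h 3 - β, h 2 + h 3]]
  let col : Fin 3 → Fin 3 → ℝ := fun a => ![e 0 a, e 1 a, e 2 a]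
  have hL : ∀ i a, L i ⬝ᵥ col a = 0 := by
    intro i a
    have s := hsum a
    have e0 := h0 a
    have e1 := h1 a
    have e2 := h2 a
    have e3 := h3 a
    fin_cases i <;> simp [L, col, dotProduct, Fin.sum_univ_three]
    · linear_combination -e0 + e3 + h 3 * s
    · linear_combination -e1 + e3 + h 3 * s
    · linear_combination -e2 + e3 + h 3 * s
  -- Noncollinearity gives two independent columns in the kernel of `L`, so `L` has rank at most
  -- one.
  obtain ⟨a, b, m, n, hmn⟩ : ∃ a b m n, col a m * col b n - col a n * col b m ≠ 0 := by
    by_contra! hcon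
    apply hcol
    have hc : ∀ a b (m n : Fin 3), col a m * col b n = col a n * col b m :=
      fun a b m n => sub_eq_zero.1 (hcon a b m n)
    have h01 : ∀ a b, e 0 a * e 1 b = e 1 a * e 0 b := fun a b => hc a b 0 1
    have h02 : ∀ a b, e 0 a * e 2 b = e 2 a * e 0 b := fun a b => hc a b 0 2
    have h12 : ∀ a b, e 1 a * e 2 b = e 2 a * e 1 b := fun a b => hc a b 1 2
    have h3e : ∀ a, e 3 a = -(e 0 a + e 1 a + e 2 a) := fun a => by linarith [hsum a]
    intro i j a b
    have a1 := h01 a b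
    have a2 := h02 a b
    have a3 := h12 a b
    have b1 := h01 b a
    have b2 := h02 b a
    have b3 := h12 b a
    fin_cases i <;> fin_cases j <;> simp [h3e] <;> linarith
  have hminor : ∀ i j c d, L i c * L j d = L i d * L j c := fun i j c d =>
    minors_eq_zero_of_orthogonal hmn (hL i a) (hL i b) (hL j a) (hL j b) c d
  -- the Lagrangian
  let Q : (Fin 4 → Fin 3 → ℝ) → ℝ := fun f =>
    ∑ a, ∑ i, ∑ j, L i j * (![f 0 a, f 1 a, f 2 a] i) * (![f 0 a, f 1 a, f 2 a] j)
  have hQe : Q e = 0 := by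
    refine Finset.sum_eq_zero fun a _ => Finset.sum_eq_zero fun i _ => ?_
    have := hL i a
    simp only [dotProduct, col] at this
    calc _ = (![e 0 a, e 1 a, e 2 a] i) * ∑ j, L i j * (![e 0 a, e 1 a, e 2 a] j) := by
            rw [Finset.mul_sum]
            exact Finset.sum_congr rfl fun j _ => by ring
      _ = 0 := by rw [this, mul_zero]
  have hQ : ∀ f : Fin 4 → Fin 3 → ℝ, (∀ a, f 0 a + f 1 a + f 2 a + f 3 a = 0) →
      Q f = bendingEnergy α β f + ∑ i, h i * (f i ⬝ᵥ f i) := by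
    intro f hf
    have hf3 : ∀ a, f 3 a = -(f 0 a + f 1 a + f 2 a) := fun a => by linarith [hf a]
    simp only [Q, L, bendingEnergy, dotProduct, Fin.sum_univ_three, Fin.sum_univ_four, hf3,
      Matrix.cons_val]
    ring
  have hdiff : ∀ f : Fin 4 → Fin 3 → ℝ, (∀ a, f 0 a + f 1 a + f 2 a + f 3 a = 0) →
      (∀ i, f i ⬝ᵥ f i = e i ⬝ᵥ e i) → Q f = bendingEnergy α β f - bendingEnergy α β e := by
    intro f hf hfe
    have := hQ e hsum
    rw [hQe] at this
    rw [hQ f hf]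
    simp only [hfe]
    linarith
  -- For a symmetric matrix of rank at most one, `L ^ 2 = τ L` with `τ` the trace; hence the form
  -- has the sign of `τ`.
  let τ : ℝ := L 0 0 + L 1 1 + L 2 2
  have hs : ∀ i j, L i j = L j i := by
    intro i j
    fin_cases i <;> fin_cases j <;> rfl
  have hm : ∀ l i j, L l l * L i j = L l i * L l j := by
    intro l i j
    rw [hminor l i l j, hs i l, mul_comm]
  have hsq : ∀ g : Fin 3 → ℝ, τ * ∑ i, ∑ j, L i j * g i * g j = ∑ l, (∑ i, L l i * g i) ^ 2 := by
    intro g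
    have hτs : τ = ∑ l, L l l := (Fin.sum_univ_three fun l => L l l).symm
    rw [hτs, Finset.sum_mul]
    refine Finset.sum_congr rfl fun l _ => ?_
    rw [sq, Finset.sum_mul_sum, Finset.mul_sum]
    refine Finset.sum_congr rfl fun i _ => ?_
    rw [Finset.mul_sum]
    refine Finset.sum_congr rfl fun j _ => ?_
    linear_combination (g i * g j) * hm l i j
  have hτQ : ∀ f, 0 ≤ τ * Q f := by
    intro f
    rw [Finset.mul_sum]
    refine Finset.sum_nonneg fun a _ => ?_
    rw [hsq]
    positivity
  -- With vanishing principal minors, `τ ^ 2` is the sum of squares of all entries of `L`. So `τ =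
  -- 0` would force `α + h 3 = h 3 = 0`.
  have hτ : τ ≠ 0 := by
    intro h0
    have m1 := hm 0 1 1
    have m2 := hm 0 2 2
    have m3 := hm 1 2 2
    have hz : L 0 0 + L 1 1 + L 2 2 = 0 := h0
    have h01 : L 0 1 = 0 := by
      nlinarith [sq_nonneg (L 0 0), sq_nonneg (L 1 1), sq_nonneg (L 2 2),
        sq_nonneg (L 0 1), sq_nonneg (L 0 2), sq_nonneg (L 1 2)]
    have h02 : L 0 2 = 0 := by
      nlinarith [sq_nonneg (L 0 0), sq_nonneg (L 1 1), sq_nonneg (L 2 2),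
        sq_nonneg (L 0 1), sq_nonneg (L 0 2), sq_nonneg (L 1 2)]
    have e1 : α + h 3 = 0 := h01
    have e2 : h 3 = 0 := h02
    exact hα (by linarith)
  rcases lt_or_gt_of_ne hτ with hneg | hpos
  · right
    intro f hf hfe
    have := hτQ f
    have hd := hdiff f hf hfe
    nlinarith
  · left
    intro f hf hfe
    have := hτQ f
    have hd := hdiff f hf hfe
    nlinarith

theorem dot_sq_le (u v : Fin 3 → ℝ) : (u ⬝ᵥ v) ^ 2 ≤ (u ⬝ᵥ u) * (v ⬝ᵥ v) := by
  simp only [dotProduct, Fin.sum_univ_three]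
  nlinarith [sq_nonneg (u 0 * v 1 - u 1 * v 0), sq_nonneg (u 0 * v 2 - u 2 * v 0),
    sq_nonneg (u 1 * v 2 - u 2 * v 1)]

theorem abs_dot_le {u v : Fin 3 → ℝ} {a b : ℝ} (ha : 0 ≤ a) (hb : 0 ≤ b) (hu : u ⬝ᵥ u = a ^ 2)
    (hv : v ⬝ᵥ v = b ^ 2) : -(a * b) ≤ u ⬝ᵥ v ∧ u ⬝ᵥ v ≤ a * b := by
  have h := dot_sq_le u v
  rw [hu, hv, ← mul_pow] at h
  exact abs_le.1 (abs_le_of_sq_le_sq h (mul_nonneg ha hb))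

/-- A polygon contained in a line has a side as long as the other three together, or is an
extremum of the bending energy, or has its odd edges opposite to its even edges. -/
theorem collinear_polygon {α β : ℝ} (hα : 0 < α) (hβ : 0 < β) {e : Fin 4 → Fin 3 → ℝ}
    {r : Fin 4 → ℝ} (hr : ∀ i, 0 < r i) (hsum : ∀ a, ∑ i, e i a = 0)
    (he : ∀ i, e i ⬝ᵥ e i = r i ^ 2) (hcol : IsCollinear e) :
    (∃ i, 2 * r i = ∑ j, r j) ∨
    (∀ f : Fin 4 → Fin 3 → ℝ, (∀ i, f i ⬝ᵥ f i = e i ⬝ᵥ e i) →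
      bendingEnergy α β e ≤ bendingEnergy α β f) ∨
    (∀ f : Fin 4 → Fin 3 → ℝ, (∀ i, f i ⬝ᵥ f i = e i ⬝ᵥ e i) →
      bendingEnergy α β f ≤ bendingEnergy α β e) ∨
    (r 0 + r 2 = r 1 + r 3 ∧ e 0 ⬝ᵥ e 1 = -(r 0 * r 1) ∧ e 1 ⬝ᵥ e 2 = -(r 1 * r 2)) := by
  -- The sign `s i` is the direction of edge `i` relative to edge `0`.
  have hsgn : ∀ i, ∃ s : ℝ, (s = 1 ∨ s = -1) ∧ e 0 ⬝ᵥ e i = s * (r 0 * r i) := by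
    intro i
    have hsq : (e 0 ⬝ᵥ e i) ^ 2 = (r 0 * r i) ^ 2 := by
      rw [mul_pow, ← he, ← he]
      simp only [dotProduct, Fin.sum_univ_three]
      have h1 := hcol 0 i 0 1
      have h2 := hcol 0 i 0 2
      have h3 := hcol 0 i 1 2
      linear_combination (-(e 0 0 * e i 1 - e 0 1 * e i 0)) * h1
        - (e 0 0 * e i 2 - e 0 2 * e i 0) * h2 - (e 0 1 * e i 2 - e 0 2 * e i 1) * h3
    rcases sq_eq_sq_iff_eq_or_eq_neg.1 hsq with h | h
    · exact ⟨1, Or.inl rfl, by rw [h, one_mul]⟩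
    · exact ⟨-1, Or.inr rfl, by rw [h, neg_one_mul]⟩
  choose s hs1 hs2 using hsgn
  have hprod : ∀ i j, e i ⬝ᵥ e j = s i * s j * (r i * r j) := by
    intro i j
    have h : (e 0 ⬝ᵥ e 0) * (e i ⬝ᵥ e j) = (e 0 ⬝ᵥ e i) * (e 0 ⬝ᵥ e j) := by
      have hc : ∀ a b, e 0 a * e j b = e 0 b * e j a := fun a b => hcol 0 j a b
      simp only [dotProduct, Fin.sum_univ_three]
      linear_combination (-(e 0 1 * e i 0) + e 0 0 * e i 1) * hc 0 1
        + (-(e 0 2 * e i 0) + e 0 0 * e i 2) * hc 0 2 + (-(e 0 2 * e i 1) + e 0 1 * e i 2) * hc 1 2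
    rw [hs2 i, hs2 j, he] at h
    apply mul_left_cancel₀ (pow_ne_zero 2 (hr 0).ne')
    linear_combination h
  have hs0 : s 0 = 1 := by
    have h := hs2 0
    rw [he] at h
    have : r 0 * r 0 ≠ 0 := mul_ne_zero (hr 0).ne' (hr 0).ne'
    apply mul_right_cancel₀ this
    linear_combination -h
  have hclosed : r 0 + s 1 * r 1 + s 2 * r 2 + s 3 * r 3 = 0 := by
    have h : e 0 ⬝ᵥ e 0 + e 0 ⬝ᵥ e 1 + e 0 ⬝ᵥ e 2 + e 0 ⬝ᵥ e 3 = 0 := by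
      have h0 := hsum 0
      have h1 := hsum 1
      have h2 := hsum 2
      simp only [dotProduct, Fin.sum_univ_three, Fin.sum_univ_four] at h0 h1 h2 ⊢
      linear_combination e 0 0 * h0 + e 0 1 * h1 + e 0 2 * h2
    rw [he, hs2 1, hs2 2, hs2 3] at h
    apply mul_left_cancel₀ (hr 0).ne'
    linear_combination h
  have hp01 := hprod 0 1
  have hp12 := hprod 1 2
  rw [hs0] at hp01
  have bound : ∀ f : Fin 4 → Fin 3 → ℝ, (∀ i, f i ⬝ᵥ f i = e i ⬝ᵥ e i) →
      ∀ i j, -(r i * r j) ≤ f i ⬝ᵥ f j ∧ f i ⬝ᵥ f j ≤ r i * r j := fun f hf i j =>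
    abs_dot_le (hr i).le (hr j).le ((hf i).trans (he i)) ((hf j).trans (he j))
  have r0 := hr 0
  have r1 := hr 1
  have r2 := hr 2
  have r3 := hr 3
  -- Equal signs cannot close up. One edge against three gives a side of half the perimeter. Of the
  -- patterns two against two, `+ + - -` and `+ - - +` make both inner products extremal in
  -- favourable directions, and `+ - + -` is the wall.
  rcases hs1 1 with h1 | h1 <;> rcases hs1 2 with h2 | h2 <;> rcases hs1 3 with h3 | h3 <;>
    rw [h1, h2, h3] at hclosed <;> rw [h1] at hp01 <;> rw [h1, h2] at hp12
  · linarith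
  · exact Or.inl ⟨3, by rw [Fin.sum_univ_four]; linarith⟩
  · exact Or.inl ⟨2, by rw [Fin.sum_univ_four]; linarith⟩
  · right; right; left
    intro f hf
    have b1 := (bound f hf 0 1).2
    have b2 := (bound f hf 1 2).1
    simp only [bendingEnergy, hp01, hp12]
    nlinarith
  · exact Or.inl ⟨1, by rw [Fin.sum_univ_four]; linarith⟩
  · right; right; right
    exact ⟨by linarith, by linarith, by linarith⟩
  · right; left
    intro f hf
    have b1 := (bound f hf 0 1).1
    have b2 := (bound f hf 1 2).2
    simp only [bendingEnergy, hp01, hp12]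
    nlinarith
  · exact Or.inl ⟨0, by rw [Fin.sum_univ_four]; linarith⟩

/-! ### From commuting matrices to Lagrange multipliers. -/

/-- The hypotheses are one row of `G * Z = Z * K`, with `(p₁, q₁)` and `(p₂, q₂)` the neighbouring
rows of `Z`. Moving the neighbours to the side of `K` as rank-one matrices, whose traceless parts
are their edges, leaves a Hermitian matrix annihilated by the row `(p, q)`. -/
theorem exists_multiplier {g A B γ₁ γ₂ : ℝ} {c p q p₁ q₁ p₂ q₂ : ℂ}
    (hpq : 0 < Complex.normSq p + Complex.normSq q)
    (h1 : g * p + γ₁ * (p * star p₁ + q * star q₁) * p₁ + γ₂ * (p * star p₂ + q * star q₂) * p₂ =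
      p * A + q * star c)
    (h2 : g * q + γ₁ * (p * star p₁ + q * star q₁) * q₁ + γ₂ * (p * star p₂ + q * star q₂) * q₂ =
      p * c + q * B) :
    ∃ h : ℝ, c.re = γ₁ * (p₁ * star q₁).re + γ₂ * (p₂ * star q₂).re + h * (p * star q).re ∧
      -c.im = γ₁ * (p₁ * star q₁).im + γ₂ * (p₂ * star q₂).im + h * (p * star q).im ∧
      (A - B) / 2 = γ₁ * ((Complex.normSq p₁ - Complex.normSq q₁) / 2) +
        γ₂ * ((Complex.normSq p₂ - Complex.normSq q₂) / 2) +
        h * ((Complex.normSq p - Complex.normSq q) / 2) ∧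
      A + B - 2 * g - γ₁ * (Complex.normSq p₁ + Complex.normSq q₁) -
        γ₂ * (Complex.normSq p₂ + Complex.normSq q₂) =
          -h * (Complex.normSq p + Complex.normSq q) := by
  obtain ⟨s, s1, s2, s3, s4⟩ := exists_smul_of_row_mul_eq_zero
    (a := A - g - γ₁ * Complex.normSq p₁ - γ₂ * Complex.normSq p₂)
    (b := B - g - γ₁ * Complex.normSq q₁ - γ₂ * Complex.normSq q₂)
    (c := c - γ₁ * (star p₁ * q₁) - γ₂ * (star p₂ * q₂)) hpq
    (by
      push_cast
      rw [← Complex.mul_conj, ← Complex.mul_conj]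
      simp only [star_sub, star_mul', Complex.star_def, Complex.conj_ofReal] at h1 ⊢
      simp only [Complex.conj_conj] at h1 ⊢
      linear_combination -h1)
    (by
      push_cast
      rw [← Complex.mul_conj, ← Complex.mul_conj]
      simp only [Complex.star_def] at h2 ⊢
      linear_combination -h2)
  refine ⟨s, ?_, ?_, ?_, ?_⟩
  · simp at s1 ⊢; linarith
  · simp at s2 ⊢; linarith
  · linarith
  · linarith

/-- A Hermitian matrix representing a linear combination of the differentials of the components
of `Ψ_t`. -/
def gradMatrix (g : Fin 4 → ℝ) (γ₁ γ₂ : ℝ) (x : Mat4) : Mat4 :=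
  !![(g 0 : ℂ), γ₁ * x 0 1, 0, 0; γ₁ * x 1 0, (g 1 : ℂ), γ₂ * x 1 2, 0;
    0, γ₂ * x 2 1, (g 2 : ℂ), 0; 0, 0, 0, (g 3 : ℂ)]

theorem gradMatrix_isHermitian (g : Fin 4 → ℝ) (γ₁ γ₂ : ℝ) {x : Mat4} (hx : x.IsHermitian) :
    (gradMatrix g γ₁ γ₂ x).IsHermitian := by
  have h01 : (starRingEnd ℂ) (x 0 1) = x 1 0 := hx.apply 1 0
  have h10 : (starRingEnd ℂ) (x 1 0) = x 0 1 := hx.apply 0 1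
  have h12 : (starRingEnd ℂ) (x 1 2) = x 2 1 := hx.apply 2 1
  have h21 : (starRingEnd ℂ) (x 2 1) = x 1 2 := hx.apply 1 2
  ext i j
  fin_cases i <;> fin_cases j <;> simp [gradMatrix, h01, h10, h12, h21]

/-- Since `G` commutes with `Z * Zᴴ`, it preserves the column space of `Z`, so `G * Z = Z * K` with
`K` Hermitian of size two. The vector `k` is the traceless part of `K` and `τ` its trace; the last
clause retains the trace equation when `G` is diagonal. -/
theorem lagrange_of_commute {lam : ℝ} (hlam : 0 < lam) {Z : Matrix (Fin 4) (Fin 2) ℂ}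
    (hZ : Zᴴ * Z = (lam : ℂ) • 1) (hr : ∀ i, 0 < ((Z * Zᴴ) i i).re) (g : Fin 4 → ℝ) (γ₁ γ₂ : ℝ)
    (hcomm : Z * Zᴴ * gradMatrix g γ₁ γ₂ (Z * Zᴴ) = gradMatrix g γ₁ γ₂ (Z * Zᴴ) * (Z * Zᴴ)) :
    ∃ (k : Fin 3 → ℝ) (h : Fin 4 → ℝ) (τ : ℝ),
      (∀ a, k a = γ₁ * edge Z 1 a + h 0 * edge Z 0 a) ∧
      (∀ a, k a = γ₁ * edge Z 0 a + γ₂ * edge Z 2 a + h 1 * edge Z 1 a) ∧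
      (∀ a, k a = γ₂ * edge Z 1 a + h 2 * edge Z 2 a) ∧
      (∀ a, k a = h 3 * edge Z 3 a) ∧
      (γ₁ = 0 → γ₂ = 0 → ∀ i, τ - 2 * g i = -h i * ((Z * Zᴴ) i i).re) := by
  set G := gradMatrix g γ₁ γ₂ (Z * Zᴴ) with hG
  have hl0 : (lam : ℂ) ≠ 0 := by exact_mod_cast hlam.ne'
  set K : Matrix (Fin 2) (Fin 2) ℂ := ((lam⁻¹ : ℝ) : ℂ) • (Zᴴ * G * Z) with hK
  have hGH : G.IsHermitian :=
    gradMatrix_isHermitian g γ₁ γ₂ (Matrix.isHermitian_mul_conjTranspose_self Z)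
  have hKH : K.IsHermitian := by
    have h1 : (Zᴴ * G * Z).IsHermitian := Matrix.isHermitian_conjTranspose_mul_mul Z hGH
    rw [hK, Matrix.IsHermitian, Matrix.conjTranspose_smul, h1.eq]
    simp
  have hGZ : G * Z = Z * K := by
    have h1 : Z * (Zᴴ * G * Z) = (lam : ℂ) • (G * Z) := by
      calc Z * (Zᴴ * G * Z) = (Z * Zᴴ * G) * Z := by simp only [Matrix.mul_assoc]
        _ = G * Z * (Zᴴ * Z) := by rw [hcomm]; simp only [Matrix.mul_assoc]
        _ = (lam : ℂ) • (G * Z) := by rw [hZ, Matrix.mul_smul, Matrix.mul_one]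
    rw [hK, Matrix.mul_smul, h1, smul_smul]
    push_cast
    rw [inv_mul_cancel₀ hl0, one_smul]
  have hA : K 0 0 = ((K 0 0).re : ℂ) := (Complex.conj_eq_iff_re.1 (hKH.apply 0 0)).symm
  have hB : K 1 1 = ((K 1 1).re : ℂ) := (Complex.conj_eq_iff_re.1 (hKH.apply 1 1)).symm
  have hC : K 1 0 = star (K 0 1) := (hKH.apply 1 0).symm
  have row : ∀ i j, ∑ l, G i l * Z l j = Z i 0 * K 0 j + Z i 1 * K 1 j := by
    intro i j
    have := congrFun (congrFun hGZ i) j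
    simpa only [Matrix.mul_apply, Fin.sum_univ_two] using this
  have hpos : ∀ i, 0 < Complex.normSq (Z i 0) + Complex.normSq (Z i 1) := by
    intro i
    rw [← gram_diag_re]
    exact hr i
  have entry : ∀ i j, (Z * Zᴴ) i j = Z i 0 * star (Z j 0) + Z i 1 * star (Z j 1) := by
    intro i j
    simp [Matrix.mul_apply]
  have row0 : ∀ i, ∑ l, G i l * Z l 0 = Z i 0 * ((K 0 0).re : ℂ) + Z i 1 * star (K 0 1) := by
    intro i
    rw [row, ← hA, hC]
  have row1 : ∀ i, ∑ l, G i l * Z l 1 = Z i 0 * K 0 1 + Z i 1 * ((K 1 1).re : ℂ) := by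
    intro i
    rw [row, ← hB]
  simp only [Fin.sum_univ_four] at row0 row1
  obtain ⟨m0, a0, b0, c0, d0⟩ := exists_multiplier (g := g 0) (γ₁ := γ₁) (γ₂ := 0)
    (A := (K 0 0).re) (B := (K 1 1).re) (c := K 0 1) (p₁ := Z 1 0) (q₁ := Z 1 1) (p₂ := 0)
    (q₂ := 0) (hpos 0)
    (by rw [← row0 0]; simp [hG, gradMatrix, entry])
    (by rw [← row1 0]; simp [hG, gradMatrix, entry])
  obtain ⟨m1, a1, b1, c1, d1⟩ := exists_multiplier (g := g 1) (γ₁ := γ₁) (γ₂ := γ₂)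
    (A := (K 0 0).re) (B := (K 1 1).re) (c := K 0 1) (p₁ := Z 0 0) (q₁ := Z 0 1) (p₂ := Z 2 0)
    (q₂ := Z 2 1) (hpos 1)
    (by rw [← row0 1]; simp [hG, gradMatrix, entry]; ring)
    (by rw [← row1 1]; simp [hG, gradMatrix, entry]; ring)
  obtain ⟨m2, a2, b2, c2, d2⟩ := exists_multiplier (g := g 2) (γ₁ := 0) (γ₂ := γ₂)
    (A := (K 0 0).re) (B := (K 1 1).re) (c := K 0 1) (p₁ := 0) (q₁ := 0) (p₂ := Z 1 0)
    (q₂ := Z 1 1) (hpos 2)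
    (by rw [← row0 2]; simp [hG, gradMatrix, entry]; ring)
    (by rw [← row1 2]; simp [hG, gradMatrix, entry]; ring)
  obtain ⟨m3, a3, b3, c3, d3⟩ := exists_multiplier (g := g 3) (γ₁ := 0) (γ₂ := 0)
    (A := (K 0 0).re) (B := (K 1 1).re) (c := K 0 1) (p₁ := 0) (q₁ := 0) (p₂ := 0) (q₂ := 0)
    (hpos 3)
    (by rw [← row0 3]; simp [hG, gradMatrix])
    (by rw [← row1 3]; simp [hG, gradMatrix])
  refine ⟨![(K 0 1).re, -(K 0 1).im, ((K 0 0).re - (K 1 1).re) / 2], ![m0, m1, m2, m3],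
    (K 0 0).re + (K 1 1).re, ?_, ?_, ?_, ?_, ?_⟩
  · intro a
    simp only [zero_mul, add_zero] at a0 b0 c0
    fin_cases a <;> simp only [edge] <;> assumption
  · intro a
    fin_cases a <;> simp only [edge] <;> assumption
  · intro a
    simp only [zero_mul, zero_add] at a2 b2 c2
    fin_cases a <;> simp only [edge] <;> assumption
  · intro a
    simp only [zero_mul, zero_add, add_zero] at a3 b3 c3
    fin_cases a <;> simp only [edge] <;> assumption
  · intro h1 h2 i
    subst h1 h2
    simp only [zero_mul, sub_zero, ← gram_diag_re] at d0 d1 d2 d3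
    fin_cases i <;> assumption

/-! ### The differential of `Ψ_t` along the unitary orbit. -/

section Differential

open scoped Matrix.Norms.Operator ComplexOrder

/-- The differential of `psiPoly t` at `x`. -/
noncomputable def psiDiff (t : ℝ) (x δ : Mat4) : Fin 4 → ℝ :=
  ![(δ 0 0).re, (δ 1 1).re, (δ 2 2).re,
    (1 - t) * (((x 0 0).re - (x 1 1).re) * ((δ 0 0).re - (δ 1 1).re) / 2 +
        2 * ((x 0 1).re * (δ 0 1).re + (x 0 1).im * (δ 0 1).im)) -
      t * (((x 1 1).re - (x 2 2).re) * ((δ 1 1).re - (δ 2 2).re) / 2 +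
        2 * ((x 1 2).re * (δ 1 2).re + (x 1 2).im * (δ 1 2).im))]

theorem contDiff_re_entry (i j : Fin 4) : ContDiff ℝ ∞ fun x : Mat4 => (x i j).re :=
  (Complex.reLm.comp (Matrix.entryLinearMap ℝ ℂ i j)).toContinuousLinearMap.contDiff

theorem contDiff_im_entry (i j : Fin 4) : ContDiff ℝ ∞ fun x : Mat4 => (x i j).im :=
  (Complex.imLm.comp (Matrix.entryLinearMap ℝ ℂ i j)).toContinuousLinearMap.contDiff

theorem contDiff_entry (i j : Fin 4) : ContDiff ℝ ∞ fun x : Mat4 => x i j :=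
  (Matrix.entryLinearMap ℝ ℂ i j).toContinuousLinearMap.contDiff

theorem contDiff_psiPoly (t : ℝ) : ContDiff ℝ ∞ (psiPoly t) := by
  have hr := contDiff_re_entry
  have hi := contDiff_im_entry
  rw [contDiff_pi]
  intro i
  fin_cases i
  · exact hr 0 0
  · exact hr 1 1
  · exact hr 2 2
  · simp only [psiPoly, Complex.normSq_apply, Fin.reduceFinMk, Matrix.cons_val]
    have h00 := hr 0 0
    have h11 := hr 1 1
    have h22 := hr 2 2
    have h01 := hr 0 1
    have h12 := hr 1 2
    have i01 := hi 0 1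
    have i12 := hi 1 2
    fun_prop

theorem fderiv_psiPoly (t : ℝ) (x δ : Mat4) : fderiv ℝ (psiPoly t) x δ = psiDiff t x δ := by
  have h1 : HasDerivAt (fun s : ℝ => psiPoly t (x + s • δ)) (fderiv ℝ (psiPoly t) x δ) 0 :=
    (((contDiff_psiPoly t).differentiable (by simp)) x).hasFDerivAt.hasLineDerivAt δ
  have haff : ∀ a b : ℝ, HasDerivAt (fun s : ℝ => a + s * b) b 0 := by
    intro a b
    simpa using ((hasDerivAt_id (0 : ℝ)).mul_const b).const_add a
  have hquad : ∀ a b c : ℝ, HasDerivAt (fun s : ℝ => a + s * b + s ^ 2 * c) b 0 := by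
    intro a b c
    exact ((haff a b).add (((hasDerivAt_id (0 : ℝ)).pow 2).mul_const c)).congr_deriv (by simp)
  have h2 : HasDerivAt (fun s : ℝ => psiPoly t (x + s • δ)) (psiDiff t x δ) 0 := by
    rw [hasDerivAt_pi]
    intro i
    fin_cases i
    · simpa [psiPoly, psiDiff] using haff (x 0 0).re (δ 0 0).re
    · simpa [psiPoly, psiDiff] using haff (x 1 1).re (δ 1 1).re
    · simpa [psiPoly, psiDiff] using haff (x 2 2).re (δ 2 2).re
    -- The fourth component is a quadratic form, so its restriction to a line is a polynomial of
    -- degree two with linear coefficient `psiDiff`.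
    · have hf : (fun s : ℝ => psiPoly t (x + s • δ) 3) = fun s : ℝ =>
          psiPoly t x 3 + s * psiDiff t x δ 3 + s ^ 2 * psiPoly t δ 3 := by
        funext s
        simp [psiPoly, psiDiff, Complex.normSq_apply]
        ring
      change HasDerivAt (fun s : ℝ => psiPoly t (x + s • δ) 3) _ 0
      rw [hf]
      exact hquad _ _ _
  exact h1.unique h2

theorem hasStrictFDerivAt_psiPoly (t : ℝ) (x : Mat4) :
    HasStrictFDerivAt (psiPoly t) (fderiv ℝ (psiPoly t) x) x :=
  (contDiff_psiPoly t).contDiffAt.hasStrictFDerivAt (by simp)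

/-- `Y ↦ Y - Y*`, with values in the skew-Hermitian matrices. -/
noncomputable def skewPart : Mat4 →L[ℝ] Mat4 :=
  LinearMap.toContinuousLinearMap
    { toFun := fun Y => Y - Yᴴ
      map_add' := fun Y W => by rw [Matrix.conjTranspose_add]; abel
      map_smul' := fun c Y => by
        rw [Matrix.conjTranspose_smul, smul_sub]
        simp }

theorem skewPart_apply (Y : Mat4) : skewPart Y = Y - Yᴴ := rfl

theorem skewPart_conjTranspose (Y : Mat4) : (skewPart Y)ᴴ = -skewPart Y := by
  rw [skewPart_apply, Matrix.conjTranspose_sub, Matrix.conjTranspose_conjTranspose, neg_sub]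

/-- The unitary group acting on `x`, in exponential coordinates. -/
noncomputable def orbitMap (x Y : Mat4) : Mat4 :=
  NormedSpace.exp (skewPart Y) * x * NormedSpace.exp (-skewPart Y)

theorem orbitMap_mem {lam : ℝ} {x : Mat4} (hx : x ∈ adjointOrbit lam) (Y : Mat4) :
    orbitMap x Y ∈ adjointOrbit lam := by
  have h : NormedSpace.exp (-skewPart Y) = (NormedSpace.exp (skewPart Y))ᴴ := by
    rw [← Matrix.exp_conjTranspose, skewPart_conjTranspose]
  refine conj_mem_adjointOrbit hx ?_ h
  rw [← h, ← Matrix.exp_add_of_commute (skewPart Y) (-skewPart Y) (Commute.neg_right (Commute.refl _)), add_neg_cancel,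
    NormedSpace.exp_zero]

theorem orbitMap_zero (x : Mat4) : orbitMap x 0 = x := by
  simp [orbitMap, NormedSpace.exp_zero]

theorem contDiff_orbitMap (x : Mat4) : ContDiff ℝ ∞ (orbitMap x) := by
  have hexp : ContDiff ℝ ∞ (NormedSpace.exp : Mat4 → Mat4) := by
    rw [contDiff_iff_contDiffAt]
    intro y
    exact (NormedSpace.exp_analytic (𝕂 := ℝ) y).contDiffAt
  have h1 : ContDiff ℝ ∞ fun Y => NormedSpace.exp (skewPart Y) := hexp.comp skewPart.contDiff
  have h2 : ContDiff ℝ ∞ fun Y => NormedSpace.exp (-skewPart Y) :=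
    hexp.comp skewPart.contDiff.neg
  exact (h1.mul contDiff_const).mul h2

theorem fderiv_orbitMap (x Y : Mat4) :
    fderiv ℝ (orbitMap x) 0 Y = skewPart Y * x - x * skewPart Y := by
  have hexp : HasFDerivAt (NormedSpace.exp : Mat4 → Mat4) (1 : Mat4 →L[ℝ] Mat4) 0 :=
    hasFDerivAt_exp_zero
  have h1 : HasFDerivAt (fun Y => NormedSpace.exp (skewPart Y)) skewPart 0 := by
    have h0 : HasFDerivAt (NormedSpace.exp : Mat4 → Mat4) (1 : Mat4 →L[ℝ] Mat4) (skewPart 0) := by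
      rw [map_zero]; exact hexp
    exact (h0.comp 0 skewPart.hasFDerivAt).congr_fderiv (by ext; rfl)
  have h2 : HasFDerivAt (fun Y => NormedSpace.exp (-skewPart Y)) (-skewPart) 0 := by
    have h0 : HasFDerivAt (NormedSpace.exp : Mat4 → Mat4) (1 : Mat4 →L[ℝ] Mat4)
        (-skewPart 0) := by
      rw [map_zero, neg_zero]; exact hexp
    exact (h0.comp 0 skewPart.hasFDerivAt.neg).congr_fderiv (by ext; rfl)
  have h4 := DFunLike.congr_fun ((h1.mul_const' x).mul' h2).fderiv Y
  refine h4.trans ?_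
  change NormedSpace.exp (skewPart 0) * x * -skewPart Y +
    skewPart Y * x * NormedSpace.exp (-skewPart 0) = _
  rw [map_zero, neg_zero, NormedSpace.exp_zero, one_mul, mul_one, mul_neg]
  abel

/-- The differential at `x` of `Ψ_t` along the unitary orbit of `x`. -/
noncomputable def orbitDiff (t : ℝ) (x : Mat4) : Mat4 →L[ℝ] (Fin 4 → ℝ) :=
  (fderiv ℝ (psiPoly t) x).comp (fderiv ℝ (orbitMap x) 0)

theorem orbitDiff_apply (t : ℝ) (x Y : Mat4) :
    orbitDiff t x Y = psiDiff t x (skewPart Y * x - x * skewPart Y) := by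
  rw [orbitDiff, ContinuousLinearMap.comp_apply, fderiv_psiPoly, fderiv_orbitMap]

theorem hasStrictFDerivAt_psiPoly_orbitMap (t : ℝ) (x : Mat4) :
    HasStrictFDerivAt (fun Y => psiPoly t (orbitMap x Y)) (orbitDiff t x) 0 := by
  have h := hasStrictFDerivAt_psiPoly t (orbitMap x 0)
  have h2 : HasStrictFDerivAt (orbitMap x) (fderiv ℝ (orbitMap x) 0) 0 :=
    (contDiff_orbitMap x).contDiffAt.hasStrictFDerivAt (by simp)
  have h3 := h.comp (0 : Mat4) h2
  rw [orbitMap_zero] at h3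
  exact h3

theorem isRegularPoint_of_surjective {lam t : ℝ} {x : Mat4} (hx : x ∈ adjointOrbit lam)
    (hs : Function.Surjective (orbitDiff t x)) : IsRegularPoint lam t x := by
  intro w
  obtain ⟨Y, rfl⟩ := hs w
  refine ⟨fun s => orbitMap x (s • Y), ⟨?_, fun s => orbitMap_mem hx _, ?_⟩, ?_⟩
  · intro i j
    exact (contDiff_entry i j).comp ((contDiff_orbitMap x).comp (contDiff_id.smul contDiff_const))
  · simp [orbitMap_zero]
  · have h := (hasStrictFDerivAt_psiPoly_orbitMap t x).hasFDerivAt.hasLineDerivAt Y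
    rw [HasLineDerivAt] at h
    simp only [zero_add] at h
    have hf : (fun s : ℝ => Psi t (orbitMap x (s • Y))) = fun s : ℝ =>
        psiPoly t (orbitMap x (s • Y)) :=
      funext fun s => Psi_eq_psiPoly t (orbitMap_mem hx _).1
    rw [hf]
    exact h

/-- A strictly differentiable map with surjective differential is open at the point, and the orbit
parametrization stays in the orbit. -/
theorem mem_interior_of_surjective {lam t : ℝ} {x : Mat4} (hx : x ∈ adjointOrbit lam)
    (hs : Function.Surjective (orbitDiff t x)) : psiPoly t x ∈ interior (baseSpace lam t) := by
  have h := (hasStrictFDerivAt_psiPoly_orbitMap t x).map_nhds_eq_of_surj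
    (LinearMap.range_eq_top.2 hs)
  rw [orbitMap_zero] at h
  rw [mem_interior_iff_mem_nhds, ← h, Filter.mem_map]
  refine Filter.Eventually.of_forall fun Y => ?_
  exact ⟨_, orbitMap_mem hx Y, Psi_eq_psiPoly t (orbitMap_mem hx Y).1⟩

/-- At a point where the differential along the orbit is not onto, a nontrivial combination of
the gradients commutes with the point. -/
theorem exists_commute_of_not_surjective {t : ℝ} {x : Mat4} (hx : x.IsHermitian)
    (hs : ¬ Function.Surjective (orbitDiff t x)) :
    ∃ (g : Fin 4 → ℝ) (c : ℝ), g 3 = 0 ∧ (c = 0 → g ≠ 0) ∧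
      x * gradMatrix g (c * (1 - t)) (-(c * t)) x = gradMatrix g (c * (1 - t)) (-(c * t)) x * x := by
  have hlt : LinearMap.range (orbitDiff t x : Mat4 →ₗ[ℝ] (Fin 4 → ℝ)) < ⊤ := by
    rw [lt_top_iff_ne_top]
    exact fun h => hs (LinearMap.range_eq_top.1 h)
  obtain ⟨φ, hφ, hker⟩ := Submodule.exists_le_ker_of_lt_top _ hlt
  let c : Fin 4 → ℝ := fun i => φ (Pi.single i 1)
  have hφc : ∀ w, φ w = ∑ i, w i * c i := fun w => by
    conv_lhs => rw [← Finset.univ_sum_single w]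
    rw [map_sum]
    refine Finset.sum_congr rfl fun i _ => ?_
    rw [← smul_eq_mul, ← map_smul, ← Pi.single_smul]
    simp
  have hvan : ∀ Y, ∑ i, psiDiff t x (skewPart Y * x - x * skewPart Y) i * c i = 0 := by
    intro Y
    rw [← hφc, ← orbitDiff_apply]
    exact hker ⟨Y, rfl⟩
  -- Diagonal of the gradient of `∑ i, c i * Ψ i`. Its last entry is `0` because `x 3 3` does not
  -- occur in `Ψ_t`.
  set g : Fin 4 → ℝ := ![c 0 + c 3 * (1 - t) * ((x 0 0).re - (x 1 1).re) / 2,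
    c 1 - c 3 * (1 - t) * ((x 0 0).re - (x 1 1).re) / 2 - c 3 * t * ((x 1 1).re - (x 2 2).re) / 2,
    c 2 + c 3 * t * ((x 1 1).re - (x 2 2).re) / 2, 0] with hg
  refine ⟨g, c 3, rfl, ?_, ?_⟩
  · intro hc hg0
    apply hφ
    have h0 := congrFun hg0 0
    have h1 := congrFun hg0 1
    have h2 := congrFun hg0 2
    simp [hg, hc] at h0 h1 h2
    ext w
    simp [hφc, Fin.sum_univ_four, h0, h1, h2, hc]
  · set G := gradMatrix g (c 3 * (1 - t)) (-(c 3 * t)) x with hG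
    have hGH : G.IsHermitian := gradMatrix_isHermitian g _ _ hx
    have hpair : ∀ δ : Mat4, δ.IsHermitian →
        ∑ i, psiDiff t x δ i * c i = (Matrix.trace (G * δ)).re := by
      intro δ hδ
      have d10 : δ 1 0 = (starRingEnd ℂ) (δ 0 1) := (hδ.apply 1 0).symm
      have d21 : δ 2 1 = (starRingEnd ℂ) (δ 1 2) := (hδ.apply 2 1).symm
      have x10 : x 1 0 = (starRingEnd ℂ) (x 0 1) := (hx.apply 1 0).symm
      have x21 : x 2 1 = (starRingEnd ℂ) (x 1 2) := (hx.apply 2 1).symm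
      simp only [Matrix.trace, Matrix.diag_apply, Matrix.mul_apply, Fin.sum_univ_four]
      simp [psiDiff, hG, gradMatrix, d10, d21, x10, x21, hg]
      ring
    set M := x * G - G * x with hM
    have hMs : Mᴴ = -M := by
      rw [hM, Matrix.conjTranspose_sub, Matrix.conjTranspose_mul, Matrix.conjTranspose_mul, hx.eq,
        hGH.eq, neg_sub]
    have hskew : skewPart M = M + M := by rw [skewPart_apply, hMs, sub_neg_eq_add]
    have hδ : (skewPart M * x - x * skewPart M).IsHermitian := by
      rw [Matrix.IsHermitian, Matrix.conjTranspose_sub, Matrix.conjTranspose_mul,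
        Matrix.conjTranspose_mul, skewPart_conjTranspose, hx.eq]
      simp only [Matrix.mul_neg, Matrix.neg_mul]
      abel
    -- Test direction `M = [x, G]` itself: being skew-Hermitian it is tangent to the unitary group,
    -- and the derivative along it is `-2 * trace (M * Mᴴ)`, which forces `M = 0`.
    have h0 := hvan M
    rw [hpair _ hδ] at h0
    have htr : Matrix.trace (G * (skewPart M * x - x * skewPart M)) =
        -2 * Matrix.trace (M * Mᴴ) := by
      rw [Matrix.mul_sub, Matrix.trace_sub, ← Matrix.mul_assoc, Matrix.trace_mul_comm,
        ← Matrix.mul_assoc, ← Matrix.mul_assoc, ← Matrix.trace_sub, ← Matrix.sub_mul, ← hM, hskew,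
        hMs, Matrix.mul_add, Matrix.trace_add, Matrix.mul_neg, Matrix.trace_neg]
      ring
    have hnonneg := (Matrix.posSemidef_self_mul_conjTranspose M).trace_nonneg
    have hM0 : M = 0 := by
      rw [← Matrix.trace_mul_conjTranspose_self_eq_zero_iff]
      have him := (Complex.nonneg_iff.1 hnonneg).2
      rw [htr] at h0
      apply Complex.ext
      · simp at h0 ⊢
        exact h0
      · exact him.symm
    exact sub_eq_zero.1 hM0

end Differential

/-! ### Critical points over the interior of the base. -/

theorem gram_isHermitian (Z : Matrix (Fin 4) (Fin 2) ℂ) : (Z * Zᴴ).IsHermitian :=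
  Matrix.isHermitian_mul_conjTranspose_self Z

theorem gram_mul_self {lam : ℝ} {Z : Matrix (Fin 4) (Fin 2) ℂ} (hZ : Zᴴ * Z = (lam : ℂ) • 1) :
    Z * Zᴴ * (Z * Zᴴ) = (lam : ℂ) • (Z * Zᴴ) := by
  rw [Matrix.mul_assoc, ← Matrix.mul_assoc Zᴴ, hZ, Matrix.smul_mul, Matrix.one_mul,
    Matrix.mul_smul]

theorem mem_baseSpace_iff {lam t : ℝ} (hlam : 0 < lam) {u : Fin 4 → ℝ} :
    u ∈ baseSpace lam t ↔ ∃ Z : Matrix (Fin 4) (Fin 2) ℂ,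
      Zᴴ * Z = (lam : ℂ) • 1 ∧ psiPoly t (Z * Zᴴ) = u := by
  constructor
  · rintro ⟨x, hx, rfl⟩
    obtain ⟨Z, hZ, rfl⟩ := exists_frame_of_mem_adjointOrbit hlam hx
    exact ⟨Z, hZ, (Psi_eq_psiPoly t hx.1).symm⟩
  · rintro ⟨Z, hZ, rfl⟩
    exact ⟨_, mem_adjointOrbit_of_frame Z hZ, Psi_eq_psiPoly t (gram_isHermitian Z)⟩

theorem gram_trace {lam : ℝ} {Z : Matrix (Fin 4) (Fin 2) ℂ} (hZ : Zᴴ * Z = (lam : ℂ) • 1) :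
    ((Z * Zᴴ) 0 0).re + ((Z * Zᴴ) 1 1).re + ((Z * Zᴴ) 2 2).re + ((Z * Zᴴ) 3 3).re = 2 * lam := by
  have := ((frame_iff lam Z).1 hZ).2
  simp only [Fin.sum_univ_four] at this
  simp only [gram_diag_re]
  exact this

theorem edge_dot_self (Z : Matrix (Fin 4) (Fin 2) ℂ) (i : Fin 4) :
    edge Z i ⬝ᵥ edge Z i = (((Z * Zᴴ) i i).re / 2) ^ 2 := by
  have h : (((Z * Zᴴ) i i).re : ℂ) = (Z * Zᴴ) i i :=
    Complex.conj_eq_iff_re.1 ((gram_isHermitian Z).apply i i)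
  rw [edge_dot_edge, ← h, Complex.normSq_ofReal, Complex.ofReal_re]
  ring

theorem gram_diag_nonneg (Z : Matrix (Fin 4) (Fin 2) ℂ) (i : Fin 4) :
    0 ≤ ((Z * Zᴴ) i i).re := by
  rw [gram_diag_re]
  exact add_nonneg (Complex.normSq_nonneg _) (Complex.normSq_nonneg _)

/-- From `x ^ 2 = λ x` one gets `(x i i) ^ 2 ≤ ∑ k, |x i k|² = λ * x i i`. -/
theorem gram_diag_le {lam : ℝ} {Z : Matrix (Fin 4) (Fin 2) ℂ}
    (hZ : Zᴴ * Z = (lam : ℂ) • 1) (i : Fin 4) : ((Z * Zᴴ) i i).re ≤ lam := by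
  have hH := gram_isHermitian Z
  have h := congrArg Complex.re (congrFun (congrFun (gram_mul_self hZ) i) i)
  set x := Z * Zᴴ with hx
  have hterm : ∀ k, (x i k * x k i).re = Complex.normSq (x i k) := by
    intro k
    rw [← hH.apply k i, Complex.star_def, Complex.mul_conj, Complex.ofReal_re]
  rw [Matrix.mul_apply, Complex.re_sum] at h
  simp only [hterm, Matrix.smul_apply, smul_eq_mul, Complex.re_ofReal_mul] at h
  have h1 : Complex.normSq (x i i) ≤ ∑ k, Complex.normSq (x i k) :=
    Finset.single_le_sum (f := fun k => Complex.normSq (x i k))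
      (fun k _ => Complex.normSq_nonneg _) (Finset.mem_univ i)
  have h2 : (x i i).re * (x i i).re ≤ Complex.normSq (x i i) := by
    rw [Complex.normSq_apply]
    nlinarith [mul_self_nonneg (x i i).im]
  have h0 : 0 ≤ (x i i).re := gram_diag_nonneg Z i
  rcases h0.eq_or_lt with h0 | h0
  -- If `x i i = 0`, what remains is `0 ≤ λ`, which follows from the trace.
  · have hz := gram_trace hZ
    have := gram_diag_nonneg Z
    have a0 := this 0
    have a1 := this 1
    have a2 := this 2
    have a3 := this 3
    linarith
  · nlinarith

theorem psiPoly_gram_three (t : ℝ) (Z : Matrix (Fin 4) (Fin 2) ℂ) :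
    psiPoly t (Z * Zᴴ) 3 =
      (1 - t) * ((((Z * Zᴴ) 0 0).re / 2) ^ 2 + (((Z * Zᴴ) 1 1).re / 2) ^ 2) -
      t * ((((Z * Zᴴ) 1 1).re / 2) ^ 2 + (((Z * Zᴴ) 2 2).re / 2) ^ 2) +
      bendingEnergy (1 - t) t (edge Z) := by
  simp only [psiPoly, bendingEnergy, edge_dot_edge, Matrix.cons_val]
  ring

theorem exists_pos_add_smul_mem {S : Set (Fin 4 → ℝ)} {u : Fin 4 → ℝ} (hu : u ∈ interior S)
    (v : Fin 4 → ℝ) : ∃ ε : ℝ, 0 < ε ∧ u + ε • v ∈ S := by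
  have hc : Continuous fun ε : ℝ => u + ε • v := by fun_prop
  have h : ∀ᶠ ε in nhds (0 : ℝ), u + ε • v ∈ S := by
    apply hc.continuousAt.eventually_mem
    simpa using mem_interior_iff_mem_nhds.1 hu
  have h2 : ∀ᶠ ε in nhdsWithin (0 : ℝ) (Set.Ioi 0), u + ε • v ∈ S := nhdsWithin_le_nhds h
  obtain ⟨ε, h3, h4⟩ := (h2.and self_mem_nhdsWithin).exists
  exact ⟨ε, h4, h3⟩

theorem gram_diag_mem_Ioo {lam t : ℝ} (hlam : 0 < lam) {Z : Matrix (Fin 4) (Fin 2) ℂ}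
    (hZ : Zᴴ * Z = (lam : ℂ) • 1) (hu : psiPoly t (Z * Zᴴ) ∈ interior (baseSpace lam t))
    (i : Fin 4) : ((Z * Zᴴ) i i).re ∈ Set.Ioo 0 lam := by
  have key : ∀ v : Fin 4 → ℝ, ∃ ε : ℝ, 0 < ε ∧
      (0 ≤ ((Z * Zᴴ) 0 0).re + ε * v 0 ∧ ((Z * Zᴴ) 0 0).re + ε * v 0 ≤ lam) ∧
      (0 ≤ ((Z * Zᴴ) 1 1).re + ε * v 1 ∧ ((Z * Zᴴ) 1 1).re + ε * v 1 ≤ lam) ∧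
      (0 ≤ ((Z * Zᴴ) 2 2).re + ε * v 2 ∧ ((Z * Zᴴ) 2 2).re + ε * v 2 ≤ lam) ∧
      (0 ≤ ((Z * Zᴴ) 3 3).re - ε * (v 0 + v 1 + v 2) ∧
        ((Z * Zᴴ) 3 3).re - ε * (v 0 + v 1 + v 2) ≤ lam) := by
    intro v
    obtain ⟨ε, hε, hmem⟩ := exists_pos_add_smul_mem hu v
    obtain ⟨W, hW, hWu⟩ := (mem_baseSpace_iff hlam).1 hmem
    have h0 : ((W * Wᴴ) 0 0).re = ((Z * Zᴴ) 0 0).re + ε * v 0 := congrFun hWu 0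
    have h1 : ((W * Wᴴ) 1 1).re = ((Z * Zᴴ) 1 1).re + ε * v 1 := congrFun hWu 1
    have h2 : ((W * Wᴴ) 2 2).re = ((Z * Zᴴ) 2 2).re + ε * v 2 := congrFun hWu 2
    have h3 : ((W * Wᴴ) 3 3).re = ((Z * Zᴴ) 3 3).re - ε * (v 0 + v 1 + v 2) := by
      have := gram_trace hW
      have := gram_trace hZ
      linarith
    refine ⟨ε, hε, ?_, ?_, ?_, ?_⟩
    · rw [← h0]; exact ⟨gram_diag_nonneg W 0, gram_diag_le hW 0⟩
    · rw [← h1]; exact ⟨gram_diag_nonneg W 1, gram_diag_le hW 1⟩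
    · rw [← h2]; exact ⟨gram_diag_nonneg W 2, gram_diag_le hW 2⟩
    · rw [← h3]; exact ⟨gram_diag_nonneg W 3, gram_diag_le hW 3⟩
  -- Along `±(1, 1, 1, 0)` all four diagonal entries move strictly in both directions (the last one
  -- by `∓3ε`) while staying in `[0, λ]`.
  obtain ⟨ε, hε, p0, p1, p2, p3⟩ := key ![1, 1, 1, 0]
  obtain ⟨ε', hε', q0, q1, q2, q3⟩ := key ![-1, -1, -1, 0]
  simp at p0 p1 p2 p3 q0 q1 q2 q3
  rw [Set.mem_Ioo]
  fin_cases i <;> simp only [Fin.zero_eta, Fin.mk_one, Fin.reduceFinMk] <;> constructor <;>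
    linarith

/-- Moving only the fourth coordinate keeps the side lengths; with `s = 1` and `s = -1` the energy
of a polygon over the interior is neither maximal nor minimal. -/
theorem exists_frame_bendingEnergy_eq {lam t : ℝ} (hlam : 0 < lam)
    {Z : Matrix (Fin 4) (Fin 2) ℂ} (hZ : Zᴴ * Z = (lam : ℂ) • 1)
    (hu : psiPoly t (Z * Zᴴ) ∈ interior (baseSpace lam t)) (s : ℝ) :
    ∃ (ε : ℝ) (f : Fin 4 → Fin 3 → ℝ), 0 < ε ∧ (∀ a, ∑ i, f i a = 0) ∧
      (∀ i, f i ⬝ᵥ f i = edge Z i ⬝ᵥ edge Z i) ∧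
      bendingEnergy (1 - t) t f = bendingEnergy (1 - t) t (edge Z) + ε * s := by
  obtain ⟨ε, hε, hmem⟩ := exists_pos_add_smul_mem hu ![0, 0, 0, s]
  obtain ⟨W, hW, hWu⟩ := (mem_baseSpace_iff hlam).1 hmem
  have h0 : ((W * Wᴴ) 0 0).re = ((Z * Zᴴ) 0 0).re := by
    simpa [psiPoly] using congrFun hWu 0
  have h1 : ((W * Wᴴ) 1 1).re = ((Z * Zᴴ) 1 1).re := by
    simpa [psiPoly] using congrFun hWu 1
  have h2 : ((W * Wᴴ) 2 2).re = ((Z * Zᴴ) 2 2).re := by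
    simpa [psiPoly] using congrFun hWu 2
  have h3 : ((W * Wᴴ) 3 3).re = ((Z * Zᴴ) 3 3).re := by
    have := gram_trace hW
    have := gram_trace hZ
    linarith
  have h4 : psiPoly t (W * Wᴴ) 3 = psiPoly t (Z * Zᴴ) 3 + ε * s := congrFun hWu 3
  rw [psiPoly_gram_three, psiPoly_gram_three, h0, h1, h2] at h4
  refine ⟨ε, edge W, hε, ((frame_iff lam W).1 hW).1, ?_, by linarith⟩
  intro i
  rw [edge_dot_self, edge_dot_self]
  fin_cases i
  · exact congrArg (fun y : ℝ => (y / 2) ^ 2) h0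
  · exact congrArg (fun y : ℝ => (y / 2) ^ 2) h1
  · exact congrArg (fun y : ℝ => (y / 2) ^ 2) h2
  · exact congrArg (fun y : ℝ => (y / 2) ^ 2) h3

theorem lagrange_of_not_surjective {lam t : ℝ} (hlam : 0 < lam)
    {Z : Matrix (Fin 4) (Fin 2) ℂ} (hZ : Zᴴ * Z = (lam : ℂ) • 1)
    (hr : ∀ i, 0 < ((Z * Zᴴ) i i).re) (hs : ¬ Function.Surjective (orbitDiff t (Z * Zᴴ))) :
    ∃ (c : ℝ) (k : Fin 3 → ℝ) (h : Fin 4 → ℝ),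
      (∀ a, k a = c * (1 - t) * edge Z 1 a + h 0 * edge Z 0 a) ∧
      (∀ a, k a = c * (1 - t) * edge Z 0 a - c * t * edge Z 2 a + h 1 * edge Z 1 a) ∧
      (∀ a, k a = -(c * t) * edge Z 1 a + h 2 * edge Z 2 a) ∧
      (∀ a, k a = h 3 * edge Z 3 a) ∧ (c = 0 → IsCollinear (edge Z)) := by
  obtain ⟨g, c, hg3, hg, hcomm⟩ := exists_commute_of_not_surjective (gram_isHermitian Z) hs
  obtain ⟨k, h, τ, h0, h1, h2, h3, h4⟩ := lagrange_of_commute hlam hZ hr _ _ _ hcomm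
  refine ⟨c, k, h, h0, fun a => by rw [h1 a]; ring, h2, h3, ?_⟩
  intro hc
  subst hc
  simp only [zero_mul, neg_zero, zero_add, add_zero] at h0 h1 h2 h3 h4
  -- If `k = 0`, then all `h i` vanish since no edge is zero, so `g` is constant; the normalization
  -- `g 3 = 0` then gives `g = 0`, a contradiction.
  have hk : ∀ i a, k a = h i * edge Z i a := by
    intro i
    fin_cases i <;> assumption
  refine isCollinear_of_forall_eq_smul (k := k) (h := h) ?_ hk
  intro hk0
  apply hg rfl
  have hh : ∀ i, h i = 0 := by
    intro i
    by_contra hi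
    have he : edge Z i = 0 := by
      funext a
      have := hk i a
      rw [hk0] at this
      exact (mul_eq_zero.1 this.symm).resolve_left hi
    have h5 := edge_dot_self Z i
    rw [he, zero_dotProduct] at h5
    have := hr i
    exact (pow_ne_zero 2 (by positivity : ((Z * Zᴴ) i i).re / 2 ≠ 0)) h5.symm
  have h6 : ∀ i, τ = 2 * g i := by
    intro i
    have := h4 trivial trivial i
    rw [hh i] at this
    linarith
  funext i
  have a1 := h6 i
  have a2 := h6 3
  rw [hg3] at a2
  simp only [Pi.zero_apply]
  linarith

/-- A critical point over the interior of the base is a degenerate polygon whose odd edges are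
opposite to its even edges. -/
theorem wall_of_not_surjective {lam t : ℝ} (hlam : 0 < lam) (ht : t ∈ Set.Ioo (0 : ℝ) 1)
    {Z : Matrix (Fin 4) (Fin 2) ℂ} (hZ : Zᴴ * Z = (lam : ℂ) • 1)
    (hu : psiPoly t (Z * Zᴴ) ∈ interior (baseSpace lam t))
    (hs : ¬ Function.Surjective (orbitDiff t (Z * Zᴴ))) :
    ((Z * Zᴴ) 0 0).re + ((Z * Zᴴ) 2 2).re = ((Z * Zᴴ) 1 1).re + ((Z * Zᴴ) 3 3).re ∧
      psiPoly t (Z * Zᴴ) 3 = (1 - t) * ((((Z * Zᴴ) 0 0).re - ((Z * Zᴴ) 1 1).re) / 2) ^ 2 -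
        t * ((((Z * Zᴴ) 1 1).re - ((Z * Zᴴ) 2 2).re) / 2) ^ 2 := by
  have ht0 : 0 < t := ht.1
  have ht1 : 0 < 1 - t := sub_pos.2 ht.2
  have hd := gram_diag_mem_Ioo hlam hZ hu
  have htr := gram_trace hZ
  have hsum := ((frame_iff lam Z).1 hZ).1
  obtain ⟨c, k, h, h0, h1, h2, h3, hc⟩ :=
    lagrange_of_not_surjective hlam hZ (fun i => (hd i).1) hs
  obtain ⟨ε, f, hε, hf, hfe, hfb⟩ := exists_frame_bendingEnergy_eq hlam hZ hu 1
  obtain ⟨ε', f', hε', hf', hfe', hfb'⟩ := exists_frame_bendingEnergy_eq hlam hZ hu (-1)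
  have hcol : IsCollinear (edge Z) := by
    by_cases hc0 : c = 0
    · exact hc hc0
    · rcases critical_polygon (mul_ne_zero hc0 ht1.ne') hsum h0 h1 h2 h3 with h | h | h
      · exact h
      all_goals
        exfalso
        -- The multiplier `c` rescales the energy and may be negative, exchanging maxima and minima;
        -- both are excluded.
        have hE : ∀ e, bendingEnergy (c * (1 - t)) (c * t) e = c * bendingEnergy (1 - t) t e := by
          intro e
          simp only [bendingEnergy]
          ring
        simp only [hE] at h
        have e1 := h f hf hfe
        have e2 := h f' hf' hfe'
        rw [hfb] at e1
        rw [hfb'] at e2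
        rcases lt_or_gt_of_ne hc0 with hneg | hpos
        · nlinarith [mul_pos (neg_pos.2 hneg) hε, mul_pos (neg_pos.2 hneg) hε']
        · nlinarith [mul_pos hpos hε, mul_pos hpos hε']
  rcases collinear_polygon ht1 ht0 (r := fun i => ((Z * Zᴴ) i i).re / 2)
    -- In the first case a side of half the perimeter means `x i i = λ`, which does not occur over
    -- the interior.
    (fun i => half_pos (hd i).1) hsum (edge_dot_self Z) hcol with ⟨i, hi⟩ | h | h | ⟨hw, h01, h12⟩
  · exfalso
    rw [Fin.sum_univ_four] at hi
    have := (hd i).2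
    linarith
  · exfalso
    have := h f' hfe'
    rw [hfb'] at this
    linarith
  · exfalso
    have := h f hfe
    rw [hfb] at this
    linarith
  · refine ⟨by linarith, ?_⟩
    rw [psiPoly_gram_three, bendingEnergy, h01, h12]
    ring

/-! ### Critical points over the wall. -/

/-- A tangent vector `δ` exchanges the two eigenspaces of `x`, while `D` preserves them, so `D * δ`
has no diagonal blocks. -/
theorem trace_mul_eq_zero_of_tangent {lam : ℝ} (hlam : lam ≠ 0) {x δ D : Mat4}
    (hx : x * x = (lam : ℂ) • x) (hδ : δ * x + x * δ = (lam : ℂ) • δ) (hD : D * x = x * D) :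
    Matrix.trace (D * δ) = 0 := by
  have hl : (lam : ℂ) ≠ 0 := by exact_mod_cast hlam
  have h1 := congrArg (fun M => Matrix.trace (D * M)) hδ
  have h2 := congrArg (fun M => Matrix.trace (D * x * M)) hδ
  have e1 : Matrix.trace (D * (δ * x)) = Matrix.trace (D * x * δ) := by
    rw [← Matrix.mul_assoc, Matrix.trace_mul_comm, ← Matrix.mul_assoc, hD]
  have e2 : Matrix.trace (D * x * (δ * x)) = lam * Matrix.trace (D * x * δ) := by
    rw [← Matrix.mul_assoc, Matrix.trace_mul_comm, ← Matrix.mul_assoc, hD, ← Matrix.mul_assoc, hx,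
      Matrix.smul_mul, Matrix.smul_mul, Matrix.trace_smul, smul_eq_mul]
  have e3 : Matrix.trace (D * x * (x * δ)) = lam * Matrix.trace (D * x * δ) := by
    rw [← Matrix.mul_assoc, Matrix.mul_assoc D, hx, Matrix.mul_smul, Matrix.smul_mul,
      Matrix.trace_smul, smul_eq_mul]
  have e4 : Matrix.trace (D * (x * δ)) = Matrix.trace (D * x * δ) := by rw [Matrix.mul_assoc]
  simp only [Matrix.mul_add, Matrix.trace_add, Matrix.mul_smul, Matrix.trace_smul, smul_eq_mul,
    e1, e2, e3, e4] at h1 h2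
  have a0 : Matrix.trace (D * x * δ) = 0 := by
    apply (mul_eq_zero.1 (_ : (lam : ℂ) * Matrix.trace (D * x * δ) = 0)).resolve_left hl
    linear_combination h2
  rw [a0] at h1
  apply (mul_eq_zero.1 (_ : (lam : ℂ) * Matrix.trace (D * δ) = 0)).resolve_left hl
  linear_combination -h1

theorem mul_self_of_mem_adjointOrbit {lam : ℝ} (hlam : 0 < lam) {x : Mat4}
    (hx : x ∈ adjointOrbit lam) : x * x = (lam : ℂ) • x := by
  obtain ⟨Z, hZ, rfl⟩ := exists_frame_of_mem_adjointOrbit hlam hx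
  exact gram_mul_self hZ

/-- Differentiating `γ ^ 2 = λ γ` makes the velocity tangent, so the derivative of `x 0 0 + x 2 2`
vanishes and `(1, 0, 0, 0)` is not attained. -/
theorem not_isRegularPoint_of_commute {lam t : ℝ} (hlam : 0 < lam) {x : Mat4}
    (hx : x ∈ adjointOrbit lam)
    (hD : Matrix.diagonal ![1, 0, 1, 0] * x = x * Matrix.diagonal ![1, 0, 1, 0]) :
    ¬ IsRegularPoint lam t x := by
  intro hreg
  obtain ⟨γ, ⟨hsm, hmem, h0⟩, hder⟩ := hreg ![1, 0, 0, 0]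
  have hd : ∀ i j, HasDerivAt (fun s => γ s i j) (deriv (fun s => γ s i j) 0) 0 := fun i j =>
    ((hsm i j).differentiable (by simp) 0).hasDerivAt
  set δ : Mat4 := Matrix.of fun i j => deriv (fun s => γ s i j) 0 with hδdef
  have htan : δ * x + x * δ = (lam : ℂ) • δ := by
    ext i j
    have e1 : HasDerivAt (fun s => ∑ k, γ s i k * γ s k j)
        (∑ k, (δ i k * γ 0 k j + γ 0 i k * δ k j)) 0 :=
      HasDerivAt.fun_sum fun k _ => (hd i k).mul (hd k j)
    have e2 : HasDerivAt (fun s => (lam : ℂ) * γ s i j) ((lam : ℂ) * δ i j) 0 :=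
      (hd i j).const_mul _
    have e3 : (fun s => ∑ k, γ s i k * γ s k j) = fun s => (lam : ℂ) * γ s i j := by
      funext s
      have := congrFun (congrFun (mul_self_of_mem_adjointOrbit hlam (hmem s)) i) j
      simpa [Matrix.mul_apply] using this
    rw [e3, h0] at e1
    have e4 := e1.unique e2
    rw [Finset.sum_add_distrib] at e4
    simpa [Matrix.mul_apply] using e4
  have htr := trace_mul_eq_zero_of_tangent hlam.ne' (mul_self_of_mem_adjointOrbit hlam hx) htan hD
  rw [hasDerivAt_pi] at hder
  have d0 : (δ 0 0).re = 1 :=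
    (Complex.reCLM.hasFDerivAt.comp_hasDerivAt (0 : ℝ) (hd 0 0)).unique (hder 0)
  have d2 : (δ 2 2).re = 0 :=
    (Complex.reCLM.hasFDerivAt.comp_hasDerivAt (0 : ℝ) (hd 2 2)).unique (hder 2)
  have := congrArg Complex.re htr
  simp [Matrix.trace, Matrix.diagonal_mul, Fin.sum_univ_four, d0, d2] at this

theorem gram_entry_eq_zero {Z : Matrix (Fin 4) (Fin 2) ℂ} {i j : Fin 4}
    (h : edge Z i ⬝ᵥ edge Z j = -(((Z * Zᴴ) i i).re / 2 * (((Z * Zᴴ) j j).re / 2))) :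
    (Z * Zᴴ) i j = 0 := by
  rw [edge_dot_edge] at h
  apply Complex.normSq_eq_zero.1
  linarith

theorem diagonal_commute {x : Mat4} (hx : x.IsHermitian) (h01 : x 0 1 = 0) (h03 : x 0 3 = 0)
    (h12 : x 1 2 = 0) (h23 : x 2 3 = 0) :
    Matrix.diagonal ![1, 0, 1, 0] * x = x * Matrix.diagonal ![1, 0, 1, 0] := by
  have h10 : x 1 0 = 0 := by rw [← hx.apply 1 0, h01, star_zero]
  have h30 : x 3 0 = 0 := by rw [← hx.apply 3 0, h03, star_zero]
  have h21 : x 2 1 = 0 := by rw [← hx.apply 2 1, h12, star_zero]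
  have h32 : x 3 2 = 0 := by rw [← hx.apply 3 2, h23, star_zero]
  ext i j
  rw [Matrix.diagonal_mul, Matrix.mul_diagonal]
  fin_cases i <;> fin_cases j <;> simp [h01, h03, h12, h23, h10, h30, h21, h32]

/-- Over each point of the wall there is a degenerate polygon with odd edges opposite to the
even ones. -/
theorem exists_node {lam t : ℝ} (hlam : 0 < lam) {r : Fin 4 → ℝ} (hr : ∀ i, 0 ≤ r i)
    (hsum : r 0 + r 1 + r 2 + r 3 = lam) (hw : r 0 + r 2 = r 1 + r 3) :
    ∃ x ∈ adjointOrbit lam,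
      psiPoly t x = ![2 * r 0, 2 * r 1, 2 * r 2, nodeValue t r] ∧ ¬ IsRegularPoint lam t x := by
  obtain ⟨Z, hZ, he, hd⟩ := exists_frame_of_polygon (lam := lam)
    ![![0, 0, r 0], ![0, 0, -r 1], ![0, 0, r 2], ![0, 0, -r 3]] r hr
    (by intro i; fin_cases i <;> simp [dotProduct, Fin.sum_univ_three, sq])
    (by intro a; fin_cases a <;> simp [Fin.sum_univ_four]; linarith)
    (by rw [Fin.sum_univ_four]; exact hsum)
  have hx := mem_adjointOrbit_of_frame Z hZ
  have hz : ∀ i j, edge Z i ⬝ᵥ edge Z j = -(r i * r j) → (Z * Zᴴ) i j = 0 := by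
    intro i j h
    apply gram_entry_eq_zero
    rw [h, hd, hd]
    ring
  have h01 : (Z * Zᴴ) 0 1 = 0 := hz 0 1 (by simp [he, dotProduct, Fin.sum_univ_three])
  have h03 : (Z * Zᴴ) 0 3 = 0 := hz 0 3 (by simp [he, dotProduct, Fin.sum_univ_three])
  have h12 : (Z * Zᴴ) 1 2 = 0 := hz 1 2 (by simp [he, dotProduct, Fin.sum_univ_three])
  have h23 : (Z * Zᴴ) 2 3 = 0 := hz 2 3 (by simp [he, dotProduct, Fin.sum_univ_three])
  refine ⟨Z * Zᴴ, hx, ?_,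
    not_isRegularPoint_of_commute hlam hx (diagonal_commute hx.1 h01 h03 h12 h23)⟩
  have h3 : r 3 = r 0 - r 1 + r 2 := by linarith
  rw [psiPoly, h01, h12, hd, hd, hd, nodeValue, h3, Complex.normSq_zero]
  congr 4
  ring

/-- A nonplanar polygon with equal sides gives a regular point over the centre of the wall. -/
theorem center_mem_interior {lam t : ℝ} (hlam : 0 < lam) (ht : t ∈ Set.Ioo (0 : ℝ) 1) :
    ![lam / 2, lam / 2, lam / 2, 0] ∈ interior (baseSpace lam t) := by
  have ht0 : 0 < t := ht.1
  have ht1 : 0 < 1 - t := sub_pos.2 ht.2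
  -- For the edges chosen below, `a² + b² + c² = (λ/4)²` makes the sides equal, and `|e₁ + e₂|² =
  -- 4a²`, `|e₂ + e₃|² = 4c²`, so `(1 - t) a² = t c²` puts the fourth coordinate at `0`.
  obtain ⟨a, ha, ha2⟩ : ∃ a : ℝ, 0 < a ∧ a * a = t * (lam / 4) ^ 2 / 2 :=
    ⟨_, Real.sqrt_pos.2 (by positivity), Real.mul_self_sqrt (by positivity)⟩
  obtain ⟨b, hb, hb2⟩ : ∃ b : ℝ, 0 < b ∧ b * b = (lam / 4) ^ 2 / 2 :=
    ⟨_, Real.sqrt_pos.2 (by positivity), Real.mul_self_sqrt (by positivity)⟩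
  obtain ⟨c, hc, hc2⟩ : ∃ c : ℝ, 0 < c ∧ c * c = (1 - t) * (lam / 4) ^ 2 / 2 :=
    ⟨_, Real.sqrt_pos.2 (by positivity), Real.mul_self_sqrt (by positivity)⟩
  obtain ⟨Z, hZ, he, hd⟩ := exists_frame_of_polygon (lam := lam)
    ![![a, b, c], ![a, -b, -c], ![-a, b, -c], ![-a, -b, c]] (fun _ => lam / 4)
    (fun _ => by positivity)
    (by intro i; fin_cases i <;> simp [dotProduct, Fin.sum_univ_three] <;> linarith)
    (by intro i; fin_cases i <;> simp [Fin.sum_univ_four])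
    (by simp; ring)
  have hu : psiPoly t (Z * Zᴴ) = ![lam / 2, lam / 2, lam / 2, 0] := by
    funext i
    fin_cases i
    · simp only [psiPoly, hd]; simp; ring
    · simp only [psiPoly, hd]; simp; ring
    · simp only [psiPoly, hd]; simp; ring
    · refine (psiPoly_gram_three t Z).trans ?_
      simp [hd, he, bendingEnergy, dotProduct, Fin.sum_univ_three]
      linear_combination 2 * ha2 + 2 * (2 * t - 1) * hb2 - 2 * hc2
  rw [← hu]
  refine mem_interior_of_surjective (mem_adjointOrbit_of_frame Z hZ) ?_
  by_contra hs
  obtain ⟨m, k, h, h0, h1, h2, h3, hm⟩ := lagrange_of_not_surjective hlam hZ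
    (fun i => by rw [hd]; positivity) hs
  -- Edges `0`, `1`, `3` are linearly independent, so the coefficient of edge `1` vanishes.
  have hm0 : m = 0 := by
    have e0 := (h3 0).symm.trans (h0 0)
    have e1 := (h3 1).symm.trans (h0 1)
    have e2 := (h3 2).symm.trans (h0 2)
    simp [he] at e0 e1 e2
    have f0 : a * (h 3 + m * (1 - t) + h 0) = 0 := by linarith
    have f1 : b * (h 3 - m * (1 - t) + h 0) = 0 := by linarith
    have g0 := (mul_eq_zero.1 f0).resolve_left ha.ne'
    have g1 := (mul_eq_zero.1 f1).resolve_left hb.ne'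
    exact (mul_eq_zero.1 (by linarith : m * (1 - t) = 0)).resolve_right ht1.ne'
  have hcol := hm hm0 0 1 0 1
  simp [he] at hcol
  have := mul_pos ha hb
  linarith

/-! ### The wall as a submanifold, and the conclusion. -/

theorem isSmoothSubmanifoldOfCodim_wall {lam t : ℝ} {S U : Set (Fin 4 → ℝ)} (hU : IsOpen U)
    (hS : S = {u | sideLengths lam u ∈ wallH2 lam ∧ u 3 = nodeValue t (sideLengths lam u)} ∩ U) :
    IsSmoothSubmanifoldOfCodim 2 S := by
  intro p hp
  rw [hS] at hp
  -- The side lengths sum to `λ` automatically, so the wall equation reduces to `u 0 + u 2 = λ`.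
  let g : (Fin 4 → ℝ) → (Fin 2 → ℝ) := fun u =>
    ![u 0 + u 2 - lam, u 3 - nodeValue t (sideLengths lam u)]
  have hg : ContDiff ℝ ∞ g := by
    rw [contDiff_pi]
    intro i
    fin_cases i
    · simp only [g, Fin.zero_eta, Matrix.cons_val_zero]
      fun_prop
    · simp only [g, Fin.mk_one, Matrix.cons_val_one, nodeValue, sideLengths, Matrix.cons_val]
      fun_prop
  refine ⟨U, g, hU, hp.2, hg.contDiffOn, ?_, ?_⟩
  · intro q _ w
    have hline : ∀ v, HasDerivAt (fun s : ℝ => g (q + s • v)) (fderiv ℝ g q v) 0 := fun v =>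
      (hg.differentiable (by simp) q).hasFDerivAt.hasLineDerivAt v
    have haff : ∀ a b : ℝ, HasDerivAt (fun s : ℝ => a + s * b) b 0 := by
      intro a b
      simpa using ((hasDerivAt_id (0 : ℝ)).mul_const b).const_add a
    have e0 : fderiv ℝ g q ![1, 0, 0, 0] 0 = 1 := by
      refine (hasDerivAt_pi.1 (hline ![1, 0, 0, 0]) 0).unique ?_
      have hf : (fun s : ℝ => g (q + s • ![1, 0, 0, 0]) 0) = fun s =>
          (q 0 + q 2 - lam) + s * 1 := by
        funext s
        simp only [g, sideLengths, nodeValue, Pi.add_apply, Pi.smul_apply, smul_eq_mul,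
          Matrix.cons_val]
        ring
      rw [hf]
      exact haff _ _
    have e3 : fderiv ℝ g q ![0, 0, 0, 1] 0 = 0 := by
      refine (hasDerivAt_pi.1 (hline ![0, 0, 0, 1]) 0).unique ?_
      have hf : (fun s : ℝ => g (q + s • ![0, 0, 0, 1]) 0) = fun s =>
          (q 0 + q 2 - lam) + s * 0 := by
        funext s
        simp only [g, sideLengths, nodeValue, Pi.add_apply, Pi.smul_apply, smul_eq_mul,
          Matrix.cons_val]
        ring
      rw [hf]
      exact haff _ _
    have e3' : fderiv ℝ g q ![0, 0, 0, 1] 1 = 1 := by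
      refine (hasDerivAt_pi.1 (hline ![0, 0, 0, 1]) 1).unique ?_
      have hf : (fun s : ℝ => g (q + s • ![0, 0, 0, 1]) 1) = fun s =>
          (q 3 - nodeValue t (sideLengths lam q)) + s * 1 := by
        funext s
        simp only [g, sideLengths, nodeValue, Pi.add_apply, Pi.smul_apply, smul_eq_mul,
          Matrix.cons_val]
        ring
      rw [hf]
      exact haff _ _
    -- On the first and last coordinate directions the differential is triangular with unit
    -- diagonal.
    refine ⟨w 0 • ![1, 0, 0, 0] + (w 1 - w 0 * fderiv ℝ g q ![1, 0, 0, 0] 1) • ![0, 0, 0, 1], ?_⟩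
    rw [map_add, map_smul, map_smul]
    funext i
    fin_cases i
    · simp [e0, e3]
    · simp [e3']
  · rw [hS, Set.inter_assoc, Set.inter_self]
    ext u
    simp only [Set.mem_inter_iff, Set.mem_ofPred_eq, wallH2, sideLengths, g, Matrix.cons_val,
      funext_iff, Fin.forall_fin_two, Pi.zero_apply]
    constructor
    · rintro ⟨⟨⟨-, h1⟩, h2⟩, hu⟩
      exact ⟨hu, by linarith, by linarith⟩
    · rintro ⟨hu, h1, h2⟩
      exact ⟨⟨⟨by ring, by linarith⟩, by linarith⟩, hu⟩

theorem wall_param (lam t : ℝ) :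
    {u : Fin 4 → ℝ | sideLengths lam u ∈ wallH2 lam ∧ u 3 = nodeValue t (sideLengths lam u)} =
      {u | ∃ r ∈ wallH2 lam, u = ![2 * r 0, 2 * r 1, 2 * r 2, nodeValue t r]} := by
  ext u
  constructor
  · rintro ⟨h1, h2⟩
    refine ⟨sideLengths lam u, h1, ?_⟩
    rw [← h2]
    funext i
    fin_cases i <;> simp [sideLengths] <;> ring
  · rintro ⟨r, hr, rfl⟩
    have h : sideLengths lam ![2 * r 0, 2 * r 1, 2 * r 2, nodeValue t r] = r := by
      have := hr.1
      funext i
      fin_cases i <;> simp [sideLengths]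
      linarith
    exact ⟨by rw [h]; exact hr, by rw [h]; rfl⟩

theorem discriminantLocus_inter_interior {lam t : ℝ} (hlam : 0 < lam)
    (ht : t ∈ Set.Ioo (0 : ℝ) 1) :
    discriminantLocus lam t ∩ interior (baseSpace lam t) =
      {u | sideLengths lam u ∈ wallH2 lam ∧ u 3 = nodeValue t (sideLengths lam u)} ∩
        interior (baseSpace lam t) := by
  ext u
  constructor
  · rintro ⟨⟨x, hx, rfl, hreg⟩, hu⟩
    refine ⟨?_, hu⟩
    rw [Psi_eq_psiPoly t hx.1] at hu ⊢
    have hs := fun h => hreg (isRegularPoint_of_surjective (t := t) hx h)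
    obtain ⟨Z, hZ, rfl⟩ := exists_frame_of_mem_adjointOrbit hlam hx
    obtain ⟨h1, h2⟩ := wall_of_not_surjective hlam ht hZ hu hs
    have htr := gram_trace hZ
    have h0 : psiPoly t (Z * Zᴴ) 0 = ((Z * Zᴴ) 0 0).re := rfl
    have h1' : psiPoly t (Z * Zᴴ) 1 = ((Z * Zᴴ) 1 1).re := rfl
    have h2' : psiPoly t (Z * Zᴴ) 2 = ((Z * Zᴴ) 2 2).re := rfl
    have h02 : ((Z * Zᴴ) 2 2).re = lam - ((Z * Zᴴ) 0 0).re := by linarith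
    refine ⟨⟨?_, ?_⟩, ?_⟩
    · simp only [sideLengths, Matrix.cons_val]
      ring
    · simp only [sideLengths, Matrix.cons_val, h0, h1', h2']
      linarith
    · rw [h2]
      simp only [nodeValue, sideLengths, Matrix.cons_val, h0, h1', h2', h02]
      ring
  · rintro ⟨hS, hu⟩
    refine ⟨?_, hu⟩
    -- Any point of the fiber shows that the side lengths are nonnegative, as `exists_node`
    -- requires.
    obtain ⟨Z, hZ, hZu⟩ := (mem_baseSpace_iff hlam).1 (interior_subset hu)
    have hpos : ∀ i, 0 ≤ sideLengths lam u i := by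
      have h0 : ((Z * Zᴴ) 0 0).re = u 0 := congrFun hZu 0
      have h1 : ((Z * Zᴴ) 1 1).re = u 1 := congrFun hZu 1
      have h2 : ((Z * Zᴴ) 2 2).re = u 2 := congrFun hZu 2
      have htr := gram_trace hZ
      have hn := gram_diag_nonneg Z
      have n0 := hn 0
      have n1 := hn 1
      have n2 := hn 2
      have n3 := hn 3
      intro i
      fin_cases i <;> simp [sideLengths] <;> linarith
    obtain ⟨x, hx, hxu, hreg⟩ := exists_node (t := t) hlam hpos hS.1.1 hS.1.2
    refine ⟨x, hx, ?_, hreg⟩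
    rw [Psi_eq_psiPoly t hx.1, hxu, ← hS.2]
    funext i
    fin_cases i <;> simp [sideLengths] <;> ring

theorem mainTheorem6 (lam t : ℝ) (hlam : 0 < lam) (ht : t ∈ Set.Ioo (0 : ℝ) 1) :
    discriminantLocus lam t ∩ interior (baseSpace lam t) =
        {u | sideLengths lam u ∈ wallH2 lam ∧ u 3 = nodeValue t (sideLengths lam u)} ∩
          interior (baseSpace lam t) ∧
      {u | sideLengths lam u ∈ wallH2 lam ∧ u 3 = nodeValue t (sideLengths lam u)} =
        {u | ∃ r ∈ wallH2 lam, u = ![2 * r 0, 2 * r 1, 2 * r 2, nodeValue t r]} ∧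
      (discriminantLocus lam t ∩ interior (baseSpace lam t)).Nonempty ∧
      IsSmoothSubmanifoldOfCodim 2 (discriminantLocus lam t ∩ interior (baseSpace lam t)) := by
  have h := discriminantLocus_inter_interior hlam ht
  refine ⟨h, wall_param lam t, ?_, isSmoothSubmanifoldOfCodim_wall isOpen_interior h⟩
  rw [h]
  refine ⟨![lam / 2, lam / 2, lam / 2, 0], ?_, center_mem_interior hlam ht⟩
  rw [wall_param]
  refine ⟨fun _ => lam / 4, ⟨by ring, by ring⟩, ?_⟩
  funext i
  fin_cases i <;> simp [nodeValue] <;> ring
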